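/- **Setting.** Let $G=(V,E)$ be a finite connected undirected graph with edge costs $c_e\ge 0$ and shortest-path distance $d$. A sequence $R$ of requests (vertices) arrives online one by one; a finite sequence $\hat R$ of predicted requests is known in advance; both may contain repetitions (elements are then counted with multiplicity) and may have any lengths. The problems are: * *Steiner tree*: given a root $\rho$, maintain a growing edge set $S$ connecting each arrived request to $\rho$; the cost is $\sum_{e\in S}c_e$. * *Facility location*: facilities can be opened at any time at a vertex $v$ at cost $f_v\ge 0$; each arriving client is connected immediately and irrevocably to an open facility at cost equal to the distance; the cost is the total opening and connection cost. * *Soft-capacitated facility location*: in addition, each facility opened at $v$ serves at most $\beta_v\ge 1$ clients, and several facilities may be opened at $v$, each at cost $f_v$. $\mathrm{OPT}$ is the optimal offline cost for $R$. **Cover error.** A $k$-hyperedge cover of $A$ by $B$ is a finite set $\mathcal H$ of pairs $(A',b)$ with $A'\subseteq A$, $|A'|\le k$, $b\in B$, such that each $a\in A$ is in some $A'$. $\Gamma_k(A,B)$ is the minimum cost of such a cover ($\infty$ if there is none). For Steiner tree the cost is $\sum_{(A',b)\in\mathcal H}\gamma(A',b)$, where $\gamma(A',b)$ is the cost of an optimal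 Steiner tree for terminals $A'$ with root $b$. For the two facility location problems it is $\sum_{(A',b)\in\mathcal H}\gamma(A',b)-\sum_{b}f_b$, the last sum over those $b\in B$ whose hyperedges cover exactly one element of $A$ in total, where $\gamma(A',b)=f_b+\sum_{a\in A'}d(a,b)$, respectively $\gamma(A',b)=f_b\lceil |A'|/\beta_b\rceil+\sum_{a\in A'}d(a,b)$ in the soft-capacitated case. The cover error is $\Lambda_k=\Gamma_\infty(\hat R,R)+\Gamma_k(R,\hat R)$. **Algorithms** (Azar, Panigrahi, Touitou). Let PC be any $\nu$-approximation algorithm for the prize-collecting offline problem on $\hat R$ (solution cost plus penalties of unsatisfied requests). For $u\in\mathbb N$, $\mathrm{Partial}(u)$ is the output of PC for the first of the uniform penalties $0,x_0,2x_0,4x_0,\dots$ (where $x_0>0$ is arbitrary) for which at most $2\nu u$ requests of $\hat R$ are left unsatisfied. Each arriving request is served by an online algorithm ON, which may use everything bought so far at cost zero. Let $B$ be the total cost paid by ON so far and $\hat B$ the value of $B$ at the latest major iteration (initially $0$). If $B\ge 2\hat B$ after ON has served the request, the iteration is major: $\hat B$ is set to $B$, $\mathrm{Partial}(u)$ is bought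 for the least $u$ for which its cost is at most $3\nu\hat B$, and ON is restarted. * For Steiner tree, ON is Greedy: it connects the request to the root by a shortest path, where bought edges have cost zero. * For facility location, ON is Fotakis' primal-dual algorithm. Let $F$ be the set of open facilities and $L$ the set of clients that arrived since the last restart. When a client $x$ arrives, put $t_z=f_z-\sum_{y\in L}\max\{0,d(F,y)-d(z,y)\}+d(z,x)$ for $z\in V$. If $d(F,x)\le\min_z t_z$, no facility is opened; if $\min_z t_z\le d(F,x)$, a facility $z\notin F$ minimising $t_z$ is opened (at equality either may happen; $d(\emptyset,x)=\infty$). Then $x$ is connected to the closest open facility. * For soft-capacitated facility location, the facility location algorithm is run with the connection cost of a client $x$ to a facility at $v$ replaced by $d(v,x)+f_v/\beta_v$ (both in ON and in the prize-collecting problem); one facility is opened at $v$ when that algorithm opens $v$, and a further one whenever a client is connected to $v$ and all facilities there are full. **Theorem 3.** For every $\nu\ge 1$ there is a constant $C>0$, depending on $\nu$ only, such that for each of the three problems, every instance, every prediction $\hat R$, every such PC, and every $x_0>0$, the algorithm can be executed on $R$, and for every way in which ties are broken its cost is at most $$C\cdot\mathrm{OPT}+C\,(1+\log k)\cdot\Lambda_k\qquad\text{simultaneously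 for all integers }k\ge 1 .$$ -/

import Mathlib

open scoped ENNReal

universe u

noncomputable section

/-! ### Hyperedge covers and the cover error -/

section Cover

variable {A B : Type*}

/-- `H` is a `k`-hyperedge cover of `A` by `B`. A hyperedge `(A', b)` has the endpoint `b` in `B`
and the endpoints `A'` in `A`, of which there are at most `k`; every element of `A` has to lie in
some hyperedge of `H`. -/
def IsHyperedgeCover (k : ℕ∞) (H : Finset (Finset A × B)) : Prop :=
  (∀ h ∈ H, (h.1.card : ℕ∞) ≤ k) ∧ ∀ a : A, ∃ h ∈ H, a ∈ h.1

/-- The minimum cost of a `k`-hyperedge cover of `A` by `B`; it is `∞` if there is no cover. -/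
def coverValue (cost : Finset (Finset A × B) → ℝ) (k : ℕ∞) : ℝ≥0∞ :=
  ⨅ (H : Finset (Finset A × B)) (_ : IsHyperedgeCover k H), ENNReal.ofReal (cost H)

/-- The total cost of a set of hyperedges with hyperedge costs `γ`. -/
def sumCost (γ : Finset A → B → ℝ) (H : Finset (Finset A × B)) : ℝ :=
  ∑ h ∈ H, γ h.1 h.2

open Classical in
/-- The subset of `A` that is covered by `b` in `H`. -/
def coveredBy (H : Finset (Finset A × B)) (b : B) : Finset A :=
  (H.filter fun h => h.2 = b).biUnion fun h => h.1

open Classical in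
/-- The refined total cost: the opening cost `f b` is deducted for every `b` that covers
exactly one element of `A`. -/
def refinedCost [Fintype B] (f : B → ℝ) (γ : Finset A → B → ℝ) (H : Finset (Finset A × B)) : ℝ :=
  sumCost γ H - ∑ b ∈ Finset.univ.filter (fun b => (coveredBy H b).card = 1), f b

end Cover

/-! ### The framework: an online algorithm combined with partial solutions for the prediction -/

/-- An offline prize-collecting problem with request set `ι`: its solutions, their costs, and the
requests that they leave unsatisfied. -/
structure PrizeCollecting (ι Sol : Type*) where
  IsSol : Sol → Prop
  cost : Sol → ℝ
  unsat : Sol → Finset ι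

namespace PrizeCollecting

variable {ι Sol : Type*} (P : PrizeCollecting ι Sol)

/-- Cost of the solution plus penalties of the unsatisfied requests. -/
def pcCost (pen : ι → ℝ) (S : Sol) : ℝ := P.cost S + ∑ i ∈ P.unsat S, pen i

/-- `PC` is a `ν`-approximation algorithm for the prize-collecting problem. -/
def IsApprox (ν : ℝ) (PC : (ι → ℝ) → Sol) : Prop :=
  ∀ pen : ι → ℝ, (∀ i, 0 ≤ pen i) →
    P.IsSol (PC pen) ∧ ∀ S, P.IsSol S → P.pcCost pen (PC pen) ≤ ν * P.pcCost pen S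

/-- `PC`, run with the uniform penalty `x`, leaves at most `2 ν u` requests unsatisfied. -/
def LeavesFew (ν : ℝ) (PC : (ι → ℝ) → Sol) (u : ℕ) (x : ℝ) : Prop :=
  ((P.unsat (PC fun _ => x)).card : ℝ) ≤ 2 * ν * u

open Classical in
/-- The subroutine Partial with target number `u` of unsatisfied requests: run `PC` with the
uniform penalties `0, x₀, 2 x₀, 4 x₀, …` and return its first output that leaves at most `2 ν u`
requests unsatisfied. (For `u = 0`, all requests are satisfied.) -/
def partialSol (ν x₀ : ℝ) (PC : (ι → ℝ) → Sol) (u : ℕ) : Sol :=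
  if P.LeavesFew ν PC u 0 then PC fun _ => 0
  else PC fun _ => x₀ * 2 ^ sInf {n : ℕ | P.LeavesFew ν PC u (x₀ * 2 ^ n)}

end PrizeCollecting

/-- The components that the framework combines: the prize-collecting offline problem for the
predicted requests `ι`; an online algorithm with configurations `Cfg` (`on s r s' g`: in
configuration `s`, it may serve the request `r` by moving to configuration `s'` at cost `g`); and
the effect of buying an offline solution, after which the online algorithm is restarted with
everything bought so far available at cost zero. -/
structure Components (ι Sol Cfg Req : Type*) where
  offline : PrizeCollecting ι Sol
  start : Cfg
  on : Cfg → Req → Cfg → ℝ → Prop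
  buy : Sol → Cfg → Cfg

/-- State of the framework: the configuration, the total cost `total` paid so far by the online
algorithm, and the value `last` of this total at the latest major iteration. -/
structure FrameworkState (Cfg : Type*) where
  cfg : Cfg
  total : ℝ
  last : ℝ

/-- `Run A ν x₀ PC R s`: the framework may reach state `s` by serving the request sequence `R`
(all ways of breaking ties of the online algorithm are allowed). Each request is served by the
online algorithm. If thereby the total online cost has at least doubled since the latest major
iteration, then the iteration is major: with the new total `T`, the solution Partial with the
least `u` for which it costs at most `3 ν T` is bought. -/
inductive Run {ι Sol Cfg Req : Type*} (A : Components ι Sol Cfg Req) (ν x₀ : ℝ)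
    (PC : (ι → ℝ) → Sol) : List Req → FrameworkState Cfg → Prop
  | nil : Run A ν x₀ PC [] ⟨A.start, 0, 0⟩
  | minor {R : List Req} {s : FrameworkState Cfg} {r : Req} {c : Cfg} {g : ℝ} :
      Run A ν x₀ PC R s → A.on s.cfg r c g → s.total + g < 2 * s.last →
      Run A ν x₀ PC (R ++ [r]) ⟨c, s.total + g, s.last⟩
  | major {R : List Req} {s : FrameworkState Cfg} {r : Req} {c : Cfg} {g : ℝ} {u : ℕ} :
      Run A ν x₀ PC R s → A.on s.cfg r c g → 2 * s.last ≤ s.total + g →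
      IsLeast {u : ℕ | A.offline.cost (A.offline.partialSol ν x₀ PC u)
        ≤ 3 * ν * (s.total + g)} u →
      Run A ν x₀ PC (R ++ [r])
        ⟨A.buy (A.offline.partialSol ν x₀ PC u) c, s.total + g, s.total + g⟩

/-! ### Networks -/

/-- A connected undirected graph with nonnegative edge costs. -/
structure Network (V : Type u) where
  graph : SimpleGraph V
  connected : graph.Connected
  cost : Sym2 V → ℝ
  cost_nonneg : ∀ e, 0 ≤ cost e

namespace Network

variable {V : Type u} (N : Network V)

/-- Shortest path distance. -/
def dist (x y : V) : ℝ := ⨅ w : N.graph.Walk x y, (w.edges.map N.cost).sum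

/-! ### Steiner tree -/

/-- `x` and `y` are connected via the edges in `S`. -/
def Joined (S : Finset (Sym2 V)) (x y : V) : Prop :=
  (SimpleGraph.fromEdgeSet (S : Set (Sym2 V))).Reachable x y

/-- Cost of an optimal Steiner tree for the terminals `T` with root `ρ`. -/
def steinerOpt (ρ : V) (T : Finset V) : ℝ :=
  sInf {t : ℝ | ∃ S : Finset (Sym2 V), (∀ e ∈ S, e ∈ N.graph.edgeSet) ∧
    (∀ x ∈ T, Joined S x ρ) ∧ t = ∑ e ∈ S, N.cost e}

open Classical in
/-- The prize-collecting Steiner tree problem with root `ρ` for the predicted terminals. -/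
def steinerPC (ρ : V) (Rhat : List V) :
    PrizeCollecting (Fin Rhat.length) (Finset (Sym2 V)) where
  IsSol S := ∀ e ∈ S, e ∈ N.graph.edgeSet
  cost S := ∑ e ∈ S, N.cost e
  unsat S := Finset.univ.filter fun i => ¬ Joined S (Rhat.get i) ρ

open Classical in
/-- The edges that have to be added to `S` in order to contain the walk `w`. -/
def newEdges (S : Finset (Sym2 V)) {x y : V} (w : N.graph.Walk x y) : Finset (Sym2 V) :=
  w.edges.toFinset \ S

/-- The Greedy algorithm: connect `x` to the root via a shortest path, where the edges bought
already have cost zero; `S'` is the new set of bought edges, and `g` is the price of the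
added edges. -/
def GreedyStep (ρ : V) (S : Finset (Sym2 V)) (x : V) (S' : Finset (Sym2 V)) (g : ℝ) : Prop :=
  ∃ w : N.graph.Walk x ρ, w.IsPath ∧
    (∀ w' : N.graph.Walk x ρ, ∑ e ∈ N.newEdges S w, N.cost e ≤ ∑ e ∈ N.newEdges S w', N.cost e) ∧
    (∀ e, e ∈ S' ↔ e ∈ S ∨ e ∈ N.newEdges S w) ∧ g = ∑ e ∈ N.newEdges S w, N.cost e

open Classical in
/-- The learning-augmented algorithm for online Steiner tree; a configuration is the set of
bought edges. -/
def steinerAlg (ρ : V) (Rhat : List V) :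
    Components (Fin Rhat.length) (Finset (Sym2 V)) (Finset (Sym2 V)) V where
  offline := N.steinerPC ρ Rhat
  start := ∅
  on := N.GreedyStep ρ
  buy T S := S ∪ T

open Classical in
/-- Cost of the hyperedge formed by the requests `A'` (positions in `R₁`) and `b` (a position in
`R₂`): an optimal Steiner tree for the terminals `A'` with root `b`. -/
def steinerγ (R₁ R₂ : List V) (A' : Finset (Fin R₁.length)) (b : Fin R₂.length) : ℝ :=
  N.steinerOpt (R₂.get b) (A'.image R₁.get)

/-- The cover error for Steiner tree. -/
def steinerError (k : ℕ) (R Rhat : List V) : ℝ≥0∞ :=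
  coverValue (sumCost (N.steinerγ Rhat R)) ⊤ + coverValue (sumCost (N.steinerγ R Rhat)) (k : ℕ∞)

end Network

/-! ### Facility location -/

namespace Facility

variable {V : Type u}

/-- A solution in which not all clients need be connected. -/
structure PartialAssignment (ι : Type*) (V : Type u) where
  opened : Finset V
  assign : ι → Option V

/-- Configuration of an online algorithm: the open facilities, the clients that arrived since the
latest restart, and all connections (client, facility) made so far. -/
structure Config (V : Type u) where
  opened : Finset V
  clients : List V
  conns : List (V × V)

/- In this block, `f v` is the cost for opening a facility at `v`, and `κ v x` is the cost for
connecting the client `x` to a facility at `v`. -/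
variable (f : V → ℝ) (κ : V → V → ℝ)

/-- The optimal cost of opening facilities and connecting every client of `R` to one of them. -/
def opt (R : List V) : ℝ :=
  sInf {t : ℝ | ∃ (F : Finset V) (a : Fin R.length → V), (∀ i, a i ∈ F) ∧
    t = ∑ v ∈ F, f v + ∑ i, κ (a i) (R.get i)}

open Classical in
/-- The prize-collecting facility location problem for the predicted clients. -/
def pc (Rhat : List V) :
    PrizeCollecting (Fin Rhat.length) (PartialAssignment (Fin Rhat.length) V) where
  IsSol S := ∀ i v, S.assign i = some v → v ∈ S.opened
  cost S := ∑ v ∈ S.opened, f v + ∑ i, (S.assign i).elim 0 fun v => κ v (Rhat.get i)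
  unsat S := Finset.univ.filter fun i => S.assign i = none

open Classical in
/-- Connection cost of the client `x` to the closest facility in `F`
(used for nonempty `F` only). -/
def toSet (F : Finset V) (x : V) : ℝ :=
  if h : F.Nonempty then F.inf' h fun v => κ v x else 0

/-- Potential of a facility at `z`: what the earlier clients would save if it were opened. -/
def potential (s : Config V) (z : V) : ℝ :=
  (s.clients.map fun y => max 0 (toSet κ s.opened y - κ z y)).sum

/-- The value of the dual variable of the arriving client `x` at which the bids for opening a
facility at `z` would pay for its opening cost. -/
def threshold (s : Config V) (x z : V) : ℝ := f z - potential κ s z + κ z x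

/-- `v` is a facility in `F` that is closest to `x`. -/
def IsClosest (F : Finset V) (x v : V) : Prop := v ∈ F ∧ ∀ z ∈ F, κ v x ≤ κ z x

open Classical in
/-- The primal-dual algorithm of Fotakis. The dual variable of the arriving client `x` is raised
from zero. If it reaches the distance to the closest open facility first, then no facility is
opened; if it reaches a threshold first, then the corresponding facility is opened. After that,
the client is connected to the closest open facility. -/
inductive Step (s : Config V) (x : V) : Config V → ℝ → Prop
  | stay (v : V) : IsClosest κ s.opened x v → (∀ z, κ v x ≤ threshold f κ s x z) →
      Step s x ⟨s.opened, x :: s.clients, (x, v) :: s.conns⟩ (κ v x)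
  | add (w v : V) : w ∉ s.opened → (∀ z, threshold f κ s x w ≤ threshold f κ s x z) →
      (∀ z ∈ s.opened, threshold f κ s x w ≤ κ z x) →
      IsClosest κ (insert w s.opened) x v →
      Step s x ⟨insert w s.opened, x :: s.clients, (x, v) :: s.conns⟩ (f w + κ v x)

open Classical in
/-- The learning-augmented algorithm for online facility location. -/
def alg (Rhat : List V) :
    Components (Fin Rhat.length) (PartialAssignment (Fin Rhat.length) V) (Config V) V where
  offline := pc f κ Rhat
  start := ⟨∅, [], []⟩
  on := Step f κ
  buy T s := ⟨s.opened ∪ T.opened, [], s.conns⟩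

/-- Opening and connection cost of a configuration. -/
def configCost (s : Config V) : ℝ :=
  ∑ v ∈ s.opened, f v + (s.conns.map fun p => κ p.2 p.1).sum

/-- Cost of the hyperedge formed by the clients `A'` and `b`: open a facility at `b` and assign
the clients `A'` to it. -/
def γ (R₁ R₂ : List V) (A' : Finset (Fin R₁.length)) (b : Fin R₂.length) : ℝ :=
  f (R₂.get b) + ∑ a ∈ A', κ (R₂.get b) (R₁.get a)

/-- The cover error for facility location. -/
def coverError (k : ℕ) (R Rhat : List V) : ℝ≥0∞ :=
  coverValue (refinedCost (fun b => f (R.get b)) (γ f κ Rhat R)) ⊤ +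
    coverValue (refinedCost (fun b => f (Rhat.get b)) (γ f κ R Rhat)) (k : ℕ∞)

/-! ### Soft-capacitated facility location -/

/- Here `d` is the distance and `β v` is the capacity of each facility opened at `v`. -/
variable (d : V → V → ℝ) (β : V → ℕ)

open Classical in
/-- The optimal cost of opening `m v` facilities at every vertex `v` and connecting every client
of `R`, subject to the capacities. -/
def capOpt [Fintype V] (R : List V) : ℝ :=
  sInf {t : ℝ | ∃ (m : V → ℕ) (a : Fin R.length → V),
    (∀ v, (Finset.univ.filter fun i => a i = v).card ≤ m v * β v) ∧
    t = ∑ v, f v * m v + ∑ i, d (a i) (R.get i)}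

/-- The connection costs of the uncapacitated instance to which a soft-capacitated instance is
reduced: each client also pays its share `f v / β v` of the opening cost. -/
def capκ (v x : V) : ℝ := d v x + f v / β v

open Classical in
/-- Number of clients connected to `v`. -/
def load (s : Config V) (v : V) : ℕ := (s.conns.filter fun p => p.2 = v).length

/-- Cost of a configuration of the uncapacitated algorithm as a soft-capacitated solution: a first
facility is opened at `v` when `v` is opened, and a further one whenever a client is connected to
`v` and all facilities there are full. -/
def capConfigCost (s : Config V) : ℝ :=
  ∑ v ∈ s.opened, f v * (max 1 ⌈(load s v : ℝ) / β v⌉₊ : ℕ) +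
    (s.conns.map fun p => d p.2 p.1).sum

/-- Cost of the hyperedge formed by the clients `A'` and `b`: open as many facilities at `b` as
are needed for the clients `A'`, and assign them to these. -/
def capγ (R₁ R₂ : List V) (A' : Finset (Fin R₁.length)) (b : Fin R₂.length) : ℝ :=
  f (R₂.get b) * (⌈(A'.card : ℝ) / β (R₂.get b)⌉₊ : ℕ) + ∑ a ∈ A', d (R₂.get b) (R₁.get a)

/-- The cover error for soft-capacitated facility location. -/
def capCoverError (k : ℕ) (R Rhat : List V) : ℝ≥0∞ :=
  coverValue (refinedCost (fun b => f (R.get b)) (capγ f d β Rhat R)) ⊤ +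
    coverValue (refinedCost (fun b => f (Rhat.get b)) (capγ f d β R Rhat)) (k : ℕ∞)

end Facility

/-- The value `C · OPT + C · (1 + log k) · Λ`. -/
def errorBound (C : ℝ) (k : ℕ) (OPT : ℝ) (Λ : ℝ≥0∞) : ℝ≥0∞ :=
  ENNReal.ofReal (C * OPT) + ENNReal.ofReal (C * (1 + Real.log k)) * Λ

end

/-! Of the partial solutions, the analysis uses their price and one more property: once the online
cost is large enough, the purchase satisfies every prediction. An optimal solution for the requests
and a cover of the predictions by the requests together give an offline solution `S` for all
predictions, of cost at most OPT plus the cost of the cover (`exists_full_steiner`,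
`exists_full_pc`). As soon as a major iteration has online cost T with 3T ≥ cost of `S`, the target
`u = 0` is affordable.

`Run.last_le` bounds the online cost at a major iteration through the phase that it ends. If that
phase began while the online cost was still below a third of the cost of `S`, the cost cannot jump
far: before the last request it is at most doubled, and a single request costs at most O(OPT) plus
the cost of the phase. Otherwise the phase began with all predictions satisfied and costs at most
some Y; since the total doubled during it, the total is at most 2Y. The purchases form a geometric
series and only cost a constant factor (`Run.cost_le`).

It remains to bound Y by a k-cover of the requests by the predictions, losing a harmonic number, at
most 1 + log k, per hyperedge. For Greedy, the terminals of a hyperedge with connection cost at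
least c are, together with its root, pairwise at distance at least c, which a Steiner tree has to
pay for (`card_mul_le_cost`, `sum_greedy_le`). For Fotakis' algorithm, the cost is at most twice the
sum of the dual variables (`phase_cost_le_duals`), and those of the clients of one hyperedge are
bounded via the condition that no facility is overpaid (`phase_cluster_le`).

An endpoint b that covers a single element contributes no opening cost to the error. The covered
client goes to b and on to the facility that serves b; as each b is used once in this way, the
detours add up to at most the connection cost of one solution. `splitCost` records exactly what has
to be paid then. Soft capacities only add the share `f v / β v` to the connection costs;
`IsConnectionCost` is what the analysis needs of either kind of cost. -/

/-! ### Partial solutions -/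

namespace PrizeCollecting

variable {ι Sol : Type*} {P : PrizeCollecting ι Sol} {ν x₀ : ℝ} {PC : (ι → ℝ) → Sol}

theorem partialSol_eq_uniform (P : PrizeCollecting ι Sol) (hx : 0 < x₀) (PC : (ι → ℝ) → Sol)
    (u : ℕ) : ∃ x : ℝ, 0 ≤ x ∧ P.partialSol ν x₀ PC u = PC fun _ => x := by
  unfold partialSol
  split_ifs
  · exact ⟨0, le_rfl, rfl⟩
  · exact ⟨_, by positivity, rfl⟩

theorem IsApprox.isSol_partialSol (h : P.IsApprox ν PC) (hx : 0 < x₀) (u : ℕ) :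
    P.IsSol (P.partialSol ν x₀ PC u) := by
  obtain ⟨x, hx0, he⟩ := P.partialSol_eq_uniform (ν := ν) hx PC u
  rw [he]
  exact (h _ fun _ => hx0).1

theorem IsApprox.pcCost_full (h : P.IsApprox ν PC) {S : Sol} (hS : P.IsSol S)
    (hfull : P.unsat S = ∅) {x : ℝ} (hx : 0 ≤ x) :
    P.cost (PC fun _ => x) + (P.unsat (PC fun _ => x)).card * x ≤ ν * P.cost S := by
  have := (h (fun _ => x) fun _ => hx).2 S hS
  simpa [pcCost, hfull] using this

theorem IsApprox.cost_partialSol_le (h : P.IsApprox ν PC) (hx : 0 < x₀) {S : Sol}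
    (hS : P.IsSol S) (hfull : P.unsat S = ∅) (u : ℕ) :
    P.cost (P.partialSol ν x₀ PC u) ≤ ν * P.cost S := by
  obtain ⟨x, hx0, he⟩ := P.partialSol_eq_uniform (ν := ν) hx PC u
  rw [he]
  have h1 := h.pcCost_full hS hfull hx0
  have h2 : 0 ≤ ((P.unsat (PC fun _ => x)).card : ℝ) * x := by positivity
  linarith

theorem IsApprox.unsat_partialSol_zero (h : P.IsApprox ν PC) (hx : 0 < x₀)
    (hcost : ∀ S, 0 ≤ P.cost S) {S : Sol} (hS : P.IsSol S) (hfull : P.unsat S = ∅) :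
    P.unsat (P.partialSol ν x₀ PC 0) = ∅ := by
  have key : ∀ x, P.LeavesFew ν PC 0 x → P.unsat (PC fun _ => x) = ∅ := by
    intro x hl
    simp only [LeavesFew, Nat.cast_zero, mul_zero] at hl
    exact Finset.card_eq_zero.1 (by exact_mod_cast le_antisymm hl (Nat.cast_nonneg _))
  unfold partialSol
  split_ifs with h0
  · exact key _ h0
  · refine key _ (Nat.sInf_mem (s := {n : ℕ | P.LeavesFew ν PC 0 (x₀ * 2 ^ n)}) ?_)
    -- Some penalty exceeds `ν * P.cost S`, and then a single unsatisfied request would already be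
    -- too expensive. Without this, `sInf` might be taken over the empty set.
    obtain ⟨n, hn⟩ := pow_unbounded_of_one_lt (ν * P.cost S / x₀) (one_lt_two (α := ℝ))
    refine ⟨n, ?_⟩
    have h1 := h.pcCost_full hS hfull (x := x₀ * 2 ^ n) (by positivity)
    have h2 := hcost (PC fun _ => x₀ * 2 ^ n)
    rw [div_lt_iff₀ hx] at hn
    have h3 : (P.unsat (PC fun _ => x₀ * 2 ^ n)).card = 0 := by
      by_contra hne
      have h4 : (1 : ℝ) ≤ (P.unsat (PC fun _ => x₀ * 2 ^ n)).card := by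
        exact_mod_cast Nat.one_le_iff_ne_zero.2 hne
      have h5 := mul_le_mul_of_nonneg_right h4 (by positivity : 0 ≤ x₀ * 2 ^ n)
      linarith
    simp only [LeavesFew, Set.mem_ofPred_eq, h3]
    simp

/-- With penalty zero a free solution is optimal, so `PC` pays nothing; for `u` the number of all
requests this first penalty is accepted, because 2ν ≥ 1. -/
theorem IsApprox.exists_isLeast_cost_le [Fintype ι] (h : P.IsApprox ν PC) (hν : 1 ≤ ν)
    {S : Sol} (hS : P.IsSol S) (hcost : P.cost S ≤ 0) {t : ℝ} (ht : 0 ≤ t) :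
    ∃ u, IsLeast {u : ℕ | P.cost (P.partialSol ν x₀ PC u) ≤ t} u := by
  have hne : {u : ℕ | P.cost (P.partialSol ν x₀ PC u) ≤ t}.Nonempty := by
    refine ⟨Fintype.card ι, ?_⟩
    have hl : P.LeavesFew ν PC (Fintype.card ι) 0 := by
      have h1 : ((P.unsat (PC fun _ => 0)).card : ℝ) ≤ Fintype.card ι := by
        exact_mod_cast Finset.card_le_univ _
      have h2 : (0 : ℝ) ≤ Fintype.card ι := Nat.cast_nonneg _
      unfold LeavesFew
      nlinarith
    have h1 := (h (fun _ => 0) fun _ => le_rfl).2 S hS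
    simp only [pcCost, Finset.sum_const_zero, add_zero] at h1
    simp only [partialSol, hl, if_true, Set.mem_ofPred_eq]
    nlinarith
  exact ⟨_, Nat.sInf_mem hne, fun u hu => Nat.sInf_le hu⟩

end PrizeCollecting

/-! ### Phases of the framework -/

section Phase

variable {ι Sol Cfg Req : Type*}

/-- The online steps `on` serve the requests `r i`, `m ≤ i < n`, starting from `c` and ending in
`c'`, at total cost `t`; `cs i` is the configuration before request `r i`, and `g i` its cost. -/
structure IsPhase (on : Cfg → Req → Cfg → ℝ → Prop) (r : ℕ → Req) (m n : ℕ) (c c' : Cfg) (t : ℝ)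
    (cs : ℕ → Cfg) (g : ℕ → ℝ) : Prop where
  le : m ≤ n
  first : cs m = c
  last : cs n = c'
  step : ∀ i, m ≤ i → i < n → on (cs i) (r i) (cs (i + 1)) (g i)
  total : t = ∑ i ∈ Finset.Ico m n, g i

theorem IsPhase.snoc {on : Cfg → Req → Cfg → ℝ → Prop} {r : ℕ → Req} {m n : ℕ} {c c' c'' : Cfg}
    {t g₀ : ℝ} {cs : ℕ → Cfg} {g : ℕ → ℝ} (h : IsPhase on r m n c c' t cs g)
    (hs : on c' (r n) c'' g₀) :
    IsPhase on r m (n + 1) c c'' (t + g₀) (Function.update cs (n + 1) c'')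
      (Function.update g n g₀) := by
  have hle := h.le
  refine ⟨by omega, ?_, by simp, ?_, ?_⟩
  · rw [Function.update_of_ne (by omega), h.first]
  · intro i hmi hi
    rw [Function.update_of_ne (a := i) (a' := n + 1) (by omega)]
    rcases Nat.lt_succ_iff_lt_or_eq.1 hi with hlt | rfl
    · rw [Function.update_of_ne (by omega), Function.update_of_ne (by omega)]
      exact h.step i hmi hlt
    · simpa [h.last] using hs
  · rw [Finset.sum_Ico_succ_top hle, h.total, Function.update_self]
    congr 1
    refine Finset.sum_congr rfl fun i hi => ?_
    rw [Function.update_of_ne (by simp at hi; omega)]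

theorem exists_run [Fintype ι] {A : Components ι Sol Cfg Req} {ν x₀ : ℝ} {PC : (ι → ℝ) → Sol}
    (hν : 1 ≤ ν) (hPC : A.offline.IsApprox ν PC)
    {S₀ : Sol} (hS₀ : A.offline.IsSol S₀) (hS₀c : A.offline.cost S₀ ≤ 0)
    (I : Cfg → Prop) (hstart : I A.start)
    (hbuy : ∀ c u, I c → I (A.buy (A.offline.partialSol ν x₀ PC u) c))
    (hon : ∀ c r c' g, I c → A.on c r c' g → I c')
    (htot : ∀ c r, I c → ∃ c' g, A.on c r c' g)
    (hg : ∀ c r c' g, A.on c r c' g → 0 ≤ g) (R : List Req) :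
    ∃ s, Run A ν x₀ PC R s := by
  suffices ∃ s, Run A ν x₀ PC R s ∧ I s.cfg ∧ 0 ≤ s.total by
    obtain ⟨s, hs, -⟩ := this
    exact ⟨s, hs⟩
  induction R using List.reverseRecOn with
  | nil => exact ⟨_, Run.nil, hstart, le_rfl⟩
  | append_singleton R r ih =>
    obtain ⟨s, hs, hI, h0⟩ := ih
    obtain ⟨c, g, hc⟩ := htot s.cfg r hI
    have hg0 := hg _ _ _ _ hc
    rcases lt_or_ge (s.total + g) (2 * s.last) with hlt | hge
    · exact ⟨_, Run.minor hs hc hlt, hon _ _ _ _ hI hc, by simp; linarith⟩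
    · obtain ⟨u, hu⟩ := hPC.exists_isLeast_cost_le (x₀ := x₀) hν hS₀ hS₀c
        (t := 3 * ν * (s.total + g)) (by have : 0 ≤ s.total + g := by linarith
                                         positivity)
      exact ⟨_, Run.major hs hc hge hu, hbuy _ _ (hon _ _ _ _ hI hc), by simp; linarith⟩

/-- The cost of everything bought is at most a constant times the online cost at the latest major
iteration. -/
theorem Run.cost_le {A : Components ι Sol Cfg Req} {ν x₀ : ℝ} {PC : (ι → ℝ) → Sol}
    (hν : 1 ≤ ν) (W : Cfg → ℝ) (hW0 : W A.start ≤ 0)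
    (hWon : ∀ c r c' g, A.on c r c' g → W c' ≤ W c + g)
    (hWbuy : ∀ c S, W (A.buy S c) ≤ W c + A.offline.cost S)
    (hg : ∀ c r c' g, A.on c r c' g → 0 ≤ g) {R : List Req} {s : FrameworkState Cfg}
    (h : Run A ν x₀ PC R s) :
    W s.cfg ≤ s.total + 6 * ν * s.last ∧ 0 ≤ s.last ∧ s.last ≤ s.total ∧
      s.total ≤ 2 * s.last := by
  induction h with
  | nil => simpa using hW0
  | minor _ hc hlt ih =>
    have := hg _ _ _ _ hc
    have := hWon _ _ _ _ hc
    obtain ⟨h1, h2, h3, h4⟩ := ih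
    exact ⟨by simp only; linarith, h2, by simp only; linarith, hlt.le⟩
  | @major R s r c g u _ hc hge hu ih =>
    have := hg _ _ _ _ hc
    have := hWon _ _ _ _ hc
    have hb := hWbuy c (A.offline.partialSol ν x₀ PC u)
    have hu1 := hu.1
    simp only [Set.mem_ofPred_eq] at hu1
    obtain ⟨h1, h2, h3, h4⟩ := ih
    refine ⟨?_, by simp only; linarith, le_rfl, by simp only; linarith⟩
    simp only
    -- The total has doubled, so the earlier purchases use up at most half of the new allowance of
    -- 6ν times the total; the other half pays for the new purchase.
    have h6 : ν * (2 * s.last) ≤ ν * (s.total + g) :=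
      mul_le_mul_of_nonneg_left hge (by linarith)
    linarith

/-- Bound on the online cost. `S` satisfies all predicted requests; `O` and the cost of the current
phase bound the cost of a single step; `Y` bounds the cost of a phase that starts with buying a
solution that satisfies all predicted requests and costs at most `ν` times as much as `S`. -/
theorem Run.last_le {A : Components ι Sol Cfg Req} {ν x₀ : ℝ} {PC : (ι → ℝ) → Sol}
    (hν : 1 ≤ ν) (hx : 0 < x₀) (hPC : A.offline.IsApprox ν PC)
    (hcost : ∀ S, 0 ≤ A.offline.cost S)
    {S : Sol} (hS : A.offline.IsSol S) (hfull : A.offline.unsat S = ∅)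
    (I J : Cfg → Prop) (hstart : I A.start) (hJstart : J A.start)
    (hbuy : ∀ c u, I c → I (A.buy (A.offline.partialSol ν x₀ PC u) c))
    (hJbuy : ∀ c S, J (A.buy S c))
    (hon : ∀ c r c' g, I c → A.on c r c' g → I c')
    (N : ℕ) (r : ℕ → Req) {O Y : ℝ} (hO : 0 ≤ O) (hY : 0 ≤ Y)
    (hstep : ∀ m n c c' c'' t g₀ cs g, I c → J c → IsPhase A.on r m n c c' t cs g → n < N →
      A.on c' (r n) c'' g₀ → g₀ ≤ O + t)
    (hphase : ∀ m n c c' t cs g S', I c → A.offline.IsSol S' → A.offline.unsat S' = ∅ →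
      A.offline.cost S' ≤ ν * A.offline.cost S → I (A.buy S' c) →
      IsPhase A.on r m n (A.buy S' c) c' t cs g → n ≤ N → t ≤ Y)
    {R : List Req} {s : FrameworkState Cfg} (h : Run A ν x₀ PC R s) (hN : R.length ≤ N)
    (hR : ∀ i (hi : i < R.length), R[i] = r i) :
    s.last ≤ 2 * Y + A.offline.cost S + O := by
  -- The induction carries the current phase along. The last clause lists how it may have begun:
  -- with small online cost, with online cost zero (needed at the start, when nothing has been
  -- bought and `S` may be free), or by buying a solution for all predictions.
  suffices s.last ≤ 2 * Y + A.offline.cost S + O ∧ I s.cfg ∧ 0 ≤ s.last ∧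
      s.total ≤ 2 * s.last ∧ ∃ m c cs g, I c ∧ J c ∧
        IsPhase A.on r m R.length c s.cfg (s.total - s.last) cs g ∧
        (3 * s.last < A.offline.cost S ∨ s.last = 0 ∨ ∃ c₀ S', I c₀ ∧ A.offline.IsSol S' ∧
          A.offline.unsat S' = ∅ ∧ A.offline.cost S' ≤ ν * A.offline.cost S ∧
          c = A.buy S' c₀) from this.1
  have hS0 := hcost S
  induction h with
  | nil =>
    refine ⟨by simp only; linarith, hstart, le_rfl, by simp, 0, A.start, fun _ => A.start,
      fun _ => 0, hstart, hJstart, ⟨le_rfl, rfl, rfl, fun i _ hi => by simp at hi, by simp⟩,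
      Or.inr (Or.inl rfl)⟩
  | @minor R s r₀ c₁ g₀ _ hc hlt ih =>
    obtain ⟨h1, h2, h3, h4, m, c, cs, g, hI, hJ, hp, hor⟩ := ih
      (by simp at hN; omega) fun i hi => by
        have := hR i (by simp; omega)
        rwa [List.getElem_append_left hi] at this
    have hr : r₀ = r R.length := by simpa using hR R.length (by simp)
    subst hr
    refine ⟨h1, hon _ _ _ _ h2 hc, h3, hlt.le, m, c,
      Function.update cs (R.length + 1) c₁, Function.update g R.length g₀, hI, hJ, ?_, hor⟩
    have := hp.snoc hc
    rw [List.length_append, List.length_singleton]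
    convert this using 1
    simp only
    ring
  | @major R s r₀ c₁ g₀ u _ hc hge hu ih =>
    obtain ⟨h1, h2, h3, h4, m, c, cs, g, hI, hJ, hp, hor⟩ := ih
      (by simp at hN; omega) fun i hi => by
        have := hR i (by simp; omega)
        rwa [List.getElem_append_left hi] at this
    have hr : r₀ = r R.length := by simpa using hR R.length (by simp)
    subst hr
    have hIc := hon _ _ _ _ h2 hc
    have hIb := hbuy c₁ u hIc
    have hT : 0 ≤ s.total + g₀ := by linarith
    refine ⟨?_, hIb, hT, by simp only; linarith, R.length + 1, _, fun _ => _, fun _ => 0, hIb,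
      hJbuy _ _, ⟨by simp, rfl, rfl, fun i h h' => ?_, by simp⟩, ?_⟩
    · have hb := hstep m R.length c s.cfg c₁ _ g₀ cs g hI hJ hp (by simp at hN; omega) hc
      simp only
      -- In the first case the new total is at most 3 · `s.last` + `O`. In the third it is at most
      -- `s.last` + `Y`, where `s.last` is at most half of it.
      rcases hor with hlt | h0 | ⟨c₀, S', hI₀, hS', hu', hc', rfl⟩
      · linarith
      · rw [h0] at hb h4
        linarith
      · have := hphase m (R.length + 1) c₀ c₁ _ _ _ S' hI₀ hS' hu' hc' hI (hp.snoc hc)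
          (by simpa using hN)
        linarith
    · simp at h'
      omega
    · simp only
      rcases lt_or_ge (3 * (s.total + g₀)) (A.offline.cost S) with hlt | hge'
      · exact Or.inl hlt
      · refine Or.inr (Or.inr ⟨c₁, A.offline.partialSol ν x₀ PC u, hIc,
          hPC.isSol_partialSol hx u, ?_, hPC.cost_partialSol_le hx hS hfull u, rfl⟩)
        -- The solution for `u = 0` costs at most ν times as much as `S`, which is within the budget
        -- 3νT.
        have hu0 : u = 0 := by
          refine Nat.le_zero.1 (hu.2 ?_)
          have := hPC.cost_partialSol_le hx hS hfull 0
          have h6 := mul_le_mul_of_nonneg_left hge' (by linarith : 0 ≤ ν)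
          simp only [Set.mem_ofPred_eq]
          linarith
        rw [hu0]
        exact hPC.unsat_partialSol_zero hx hcost hS hfull

end Phase

/-! ### Hyperedge covers -/

section Cover

variable {A B : Type*}

theorem IsHyperedgeCover.sum_le [Fintype A] {k : ℕ∞} {H : Finset (Finset A × B)}
    (hH : IsHyperedgeCover k H) {a : A → ℝ} (ha : ∀ i, 0 ≤ a i) :
    ∑ i, a i ≤ ∑ h ∈ H, ∑ i ∈ h.1, a i := by
  classical
  calc ∑ i, a i ≤ ∑ i, ∑ h ∈ H, if i ∈ h.1 then a i else 0 := by
        refine Finset.sum_le_sum fun i _ => ?_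
        obtain ⟨h, hh, hi⟩ := hH.2 i
        refine le_trans (by simp [hi]) (Finset.single_le_sum
          (f := fun h : Finset A × B => if i ∈ h.1 then a i else 0) (fun h _ => ?_) hh)
        split_ifs
        exacts [ha i, le_rfl]
    _ = _ := by
        rw [Finset.sum_comm]
        simp

theorem exists_coverValue_eq [Fintype A] [Fintype B] (cost : Finset (Finset A × B) → ℝ) (k : ℕ∞)
    (h : coverValue cost k ≠ ∞) :
    ∃ H, IsHyperedgeCover k H ∧ coverValue cost k = ENNReal.ofReal (cost H) := by
  classical
  have hne : {H : Finset (Finset A × B) | IsHyperedgeCover k H}.Nonempty := by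
    by_contra hcon
    rw [Set.not_nonempty_iff_eq_empty] at hcon
    apply h
    simp only [coverValue, iInf_eq_top]
    intro H hH
    exact absurd (hcon ▸ hH : H ∈ (∅ : Set _)) (by simp)
  obtain ⟨H, hH, hmin⟩ := Set.exists_min_image {H : Finset (Finset A × B) | IsHyperedgeCover k H}
    (fun H => ENNReal.ofReal (cost H)) (Set.toFinite _) hne
  exact ⟨H, hH, le_antisymm (iInf₂_le H hH) (le_iInf₂ hmin)⟩

/-- Reduces the bound in `ℝ≥0∞` to a real inequality for each pair of covers: the minima are
attained if finite, and otherwise the right side is infinite because the factor of the error is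
positive. -/
theorem ofReal_le_errorBound {A' B' : Type*} [Fintype A] [Fintype B] [Fintype A'] [Fintype B']
    {cost₁ : Finset (Finset A × B) → ℝ} {cost₂ : Finset (Finset A' × B') → ℝ} {k : ℕ}
    {C O W : ℝ} (hC : 0 < C)
    (h : ∀ H₁ H₂, IsHyperedgeCover ⊤ H₁ → IsHyperedgeCover (k : ℕ∞) H₂ →
      W ≤ C * O + C * (1 + Real.log k) * (cost₁ H₁ + cost₂ H₂)) :
    ENNReal.ofReal W ≤ errorBound C k O (coverValue cost₁ ⊤ + coverValue cost₂ (k : ℕ∞)) := by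
  have hc : 0 < C * (1 + Real.log k) := by
    have := Real.log_natCast_nonneg k
    positivity
  by_cases htop : coverValue cost₁ ⊤ + coverValue cost₂ (k : ℕ∞) = ∞
  · rw [errorBound, htop, ENNReal.mul_top (by simpa using hc)]
    simp
  · rw [ENNReal.add_eq_top, not_or] at htop
    obtain ⟨H₁, h₁, e₁⟩ := exists_coverValue_eq cost₁ ⊤ htop.1
    obtain ⟨H₂, h₂, e₂⟩ := exists_coverValue_eq cost₂ k htop.2
    rw [errorBound, e₁, e₂]
    calc ENNReal.ofReal W
        ≤ ENNReal.ofReal (C * O + C * (1 + Real.log k) * (cost₁ H₁ + cost₂ H₂)) :=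
          ENNReal.ofReal_le_ofReal (h H₁ H₂ h₁ h₂)
      _ ≤ ENNReal.ofReal (C * O) +
          ENNReal.ofReal (C * (1 + Real.log k) * (cost₁ H₁ + cost₂ H₂)) := ENNReal.ofReal_add_le
      _ ≤ _ := by
          rw [ENNReal.ofReal_mul hc.le]
          gcongr
          exact ENNReal.ofReal_add_le

theorem harmonic_le_of_le {m k : ℕ} (hm : m ≤ k) :
    (harmonic m : ℝ) ≤ 1 + Real.log k := by
  rcases Nat.eq_zero_or_pos m with rfl | hpos
  · have := Real.log_natCast_nonneg k
    simp
    linarith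
  · refine (harmonic_le_one_add_log m).trans ?_
    gcongr

end Cover

/-! ### Sums over unions, and sums bounded by harmonic numbers -/

theorem List.sum_toFinset_le_sum_map {α : Type*} [DecidableEq α] (l : List α) {c : α → ℝ}
    (hc : ∀ a, 0 ≤ c a) : ∑ a ∈ l.toFinset, c a ≤ (l.map c).sum := by
  induction l with
  | nil => simp
  | cons a l ih =>
    rw [List.toFinset_cons, List.map_cons, List.sum_cons]
    by_cases ha : a ∈ l.toFinset
    · rw [Finset.insert_eq_of_mem ha]
      linarith [hc a]
    · rw [Finset.sum_insert ha]
      linarith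

theorem Finset.sum_union_le_sum_add_sum {α : Type*} [DecidableEq α] (s t : Finset α) {c : α → ℝ}
    (hc : ∀ a, 0 ≤ c a) : ∑ a ∈ s ∪ t, c a ≤ ∑ a ∈ s, c a + ∑ a ∈ t, c a := by
  rw [← Finset.sum_union_inter]
  exact le_add_of_nonneg_right (Finset.sum_nonneg fun a _ => hc a)

theorem Finset.sum_biUnion_le_sum {ι α : Type*} [DecidableEq α] (s : Finset ι) (t : ι → Finset α)
    {c : α → ℝ} (hc : ∀ a, 0 ≤ c a) : ∑ a ∈ s.biUnion t, c a ≤ ∑ i ∈ s, ∑ a ∈ t i, c a := by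
  classical
  induction s using Finset.induction_on with
  | empty => simp
  | insert i s hi ih =>
    rw [Finset.biUnion_insert, Finset.sum_insert hi]
    exact (Finset.sum_union_le_sum_add_sum _ _ hc).trans (add_le_add le_rfl ih)

/-- If any `j` of the weights are at least `c` only if `(j + 1) c ≤ G`, then the weights add up to
at most `G` times a harmonic number. -/
theorem Finset.sum_le_mul_harmonic {ι : Type*} {g : ι → ℝ} {G : ℝ} (hG : 0 ≤ G) (s : Finset ι)
    (h : ∀ P ⊆ s, P.Nonempty → ∀ c, 0 < c → (∀ i ∈ P, c ≤ g i) → ((P.card : ℝ) + 1) * c ≤ G) :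
    ∑ i ∈ s, g i ≤ G * (harmonic s.card : ℝ) := by
  classical
  induction s using Finset.strongInduction with
  | H s ih =>
    rcases s.eq_empty_or_nonempty with rfl | hne
    · simp
    · obtain ⟨i, hi, hmin⟩ := s.exists_min_image g hne
      have h1 := ih (s.erase i) (Finset.erase_ssubset hi) fun P hP =>
        h P (hP.trans (Finset.erase_subset _ _))
      have hcard : s.card = (s.erase i).card + 1 := (Finset.card_erase_add_one hi).symm
      -- All weights are at least the smallest one, `g i`, so the hypothesis applies to the whole of
      -- `s`; the additional 1 in it is given away.
      have h2 : g i ≤ G * (((s.erase i).card + 1 : ℕ) : ℝ)⁻¹ := by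
        rcases le_or_gt (g i) 0 with h0 | h0
        · exact h0.trans (by positivity)
        · rw [← div_eq_mul_inv, le_div_iff₀ (by positivity), ← hcard]
          have := h s subset_rfl hne (g i) h0 hmin
          linarith
      rw [← Finset.add_sum_erase s g hi, hcard, harmonic_succ]
      push_cast at h2 ⊢
      linarith

/-! ### The shortest-path metric -/

namespace Network

variable {V : Type u} (N : Network V)

theorem walkCost_nonneg {x y : V} (w : N.graph.Walk x y) : 0 ≤ (w.edges.map N.cost).sum :=
  List.sum_nonneg (by simpa using fun e _ => N.cost_nonneg e)

theorem dist_le {x y : V} (w : N.graph.Walk x y) : N.dist x y ≤ (w.edges.map N.cost).sum :=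
  ciInf_le ⟨0, by rintro _ ⟨w, rfl⟩; exact N.walkCost_nonneg w⟩ w

theorem le_dist {x y : V} {t : ℝ} (h : ∀ w : N.graph.Walk x y, t ≤ (w.edges.map N.cost).sum) :
    t ≤ N.dist x y :=
  haveI : Nonempty (N.graph.Walk x y) := N.connected.preconnected x y
  le_ciInf h

theorem dist_nonneg (x y : V) : 0 ≤ N.dist x y := N.le_dist N.walkCost_nonneg

theorem dist_self (x : V) : N.dist x x = 0 :=
  le_antisymm (by simpa using N.dist_le (SimpleGraph.Walk.nil : N.graph.Walk x x))
    (N.dist_nonneg x x)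

theorem dist_comm_le (x y : V) : N.dist x y ≤ N.dist y x :=
  N.le_dist fun w => by
    have := N.dist_le w.reverse
    rwa [SimpleGraph.Walk.edges_reverse, List.map_reverse, List.sum_reverse] at this

theorem dist_comm (x y : V) : N.dist x y = N.dist y x :=
  le_antisymm (N.dist_comm_le x y) (N.dist_comm_le y x)

theorem dist_triangle (x y z : V) : N.dist x z ≤ N.dist x y + N.dist y z := by
  have h : N.dist x z - N.dist y z ≤ N.dist x y := N.le_dist fun w => by
    have h : N.dist x z - (w.edges.map N.cost).sum ≤ N.dist y z := N.le_dist fun w' => by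
      have := N.dist_le (w.append w')
      simp only [SimpleGraph.Walk.edges_append, List.map_append, List.sum_append] at this
      linarith
    linarith
  linarith

theorem dist_le_cost {x y : V} (h : N.graph.Adj x y) : N.dist x y ≤ N.cost s(x, y) := by
  simpa using N.dist_le h.toWalk

/-! ### Separated terminals -/

/-- Variation of a function along an edge. -/
def variation (φ : V → ℝ) : Sym2 V → ℝ :=
  Sym2.lift ⟨fun x y => |φ x - φ y|, fun _ _ => abs_sub_comm _ _⟩

theorem variation_nonneg (φ : V → ℝ) (e : Sym2 V) : 0 ≤ variation φ e := by
  induction e with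
  | _ x y => exact abs_nonneg _

theorem abs_sub_le_sum_variation (φ : V → ℝ) {S : Finset (Sym2 V)} {x y : V}
    (h : Joined S x y) : |φ x - φ y| ≤ ∑ e ∈ S, variation φ e := by
  classical
  obtain ⟨w⟩ := h
  have h1 : ∀ {x y : V} (w : (SimpleGraph.fromEdgeSet (S : Set (Sym2 V))).Walk x y),
      |φ x - φ y| ≤ (w.edges.map (variation φ)).sum := by
    intro x y w
    induction w with
    | nil => simp
    | @cons a b c hadj w ih =>
      rw [SimpleGraph.Walk.edges_cons, List.map_cons, List.sum_cons]
      exact (abs_sub_le _ (φ b) _).trans (add_le_add le_rfl ih)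
  -- A path uses each edge at most once, so its sum over a list is a sum over a subset of `S`.
  refine (h1 w.bypass).trans ?_
  rw [← List.sum_toFinset _ w.bypass_isPath.isTrail.edges_nodup]
  refine Finset.sum_le_sum_of_subset_of_nonneg (fun e he => ?_) fun e _ _ => variation_nonneg φ e
  have := w.bypass.edges_subset_edgeSet (List.mem_toFinset.1 he)
  rw [SimpleGraph.edgeSet_fromEdgeSet] at this
  exact this.1

variable {N}

/-- If the terminals `p i` are at pairwise distance at least `c`, the balls of radius `c / 2` around
them are disjoint; a tree that connects the terminals crosses each of the balls. -/
theorem card_mul_le_cost {ι : Type*} [Fintype ι] [Nontrivial ι] {p : ι → V} {c : ℝ} (hc : 0 < c)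
    (hsep : ∀ i j, i ≠ j → c ≤ N.dist (p i) (p j)) {S : Finset (Sym2 V)}
    (hS : ∀ e ∈ S, e ∈ N.graph.edgeSet) {ρ : V} (hj : ∀ i, Joined S (p i) ρ) :
    (Fintype.card ι : ℝ) * c ≤ 2 * ∑ e ∈ S, N.cost e := by
  classical
  set ψ : ι → V → ℝ := fun i v => max 0 (c / 2 - N.dist (p i) v) with hψ
  have hψ0 : ∀ i v, 0 ≤ ψ i v := fun i v => le_max_left _ _
  have hpos : ∀ i v, 0 < ψ i v → ψ i v = c / 2 - N.dist (p i) v := by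
    intro i v h
    simp only [hψ] at h ⊢
    exact max_eq_right (by by_contra h'; rw [max_eq_left (by linarith)] at h; exact lt_irrefl _ h)
  have hlip : ∀ i x y, ψ i x ≤ ψ i y + N.dist x y := by
    intro i x y
    refine max_le (add_nonneg (hψ0 i y) (N.dist_nonneg x y)) ?_
    have h1 : c / 2 - N.dist (p i) y ≤ ψ i y := le_max_right _ _
    have h2 := N.dist_triangle (p i) x y
    linarith
  have hone : ∀ v, ∃ i₀, ∀ i, i ≠ i₀ → ψ i v = 0 := by
    intro v
    by_cases h : ∃ i, 0 < ψ i v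
    · obtain ⟨i, hi⟩ := h
      refine ⟨i, fun j hji => ?_⟩
      by_contra hne
      have hj := lt_of_le_of_ne (hψ0 j v) (Ne.symm hne)
      have h1 := hpos i v hi
      have h2 := hpos j v hj
      have h3 := N.dist_triangle (p j) v (p i)
      have h4 := hsep j i hji
      rw [N.dist_comm v] at h3
      linarith
    · push Not at h
      exact ⟨Classical.arbitrary ι, fun i _ => le_antisymm (h i) (hψ0 i v)⟩
  -- If `x` and `y` lie in different balls, the two heights add up to c minus the distances to the
  -- centres, hence to at most the distance of `x` and `y` by separation. In all other cases only
  -- one function varies, and it is 1-Lipschitz.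
  have hedge : ∀ x y, ∑ i, |ψ i x - ψ i y| ≤ N.dist x y := by
    intro x y
    have habs : ∀ i, |ψ i x - ψ i y| ≤ N.dist x y := fun i => by
      have h1 := hlip i x y
      have h2 := hlip i y x
      rw [N.dist_comm y x] at h2
      exact abs_le.2 ⟨by linarith, by linarith⟩
    obtain ⟨i₀, hi₀⟩ := hone x
    obtain ⟨j₀, hj₀⟩ := hone y
    by_cases hij : i₀ = j₀
    · subst hij
      rw [Finset.sum_eq_single i₀ (fun i _ hi => by simp [hi₀ i hi, hj₀ i hi]) (by simp)]
      exact habs i₀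
    · rw [← Finset.sum_subset (Finset.subset_univ {i₀, j₀}) (fun i _ hi => by
        simp only [Finset.mem_insert, Finset.mem_singleton, not_or] at hi
        simp [hi₀ i hi.1, hj₀ i hi.2]), Finset.sum_pair hij]
      have e1 : ψ i₀ y = 0 := hj₀ _ hij
      have e2 : ψ j₀ x = 0 := hi₀ _ (Ne.symm hij)
      have a1 := habs i₀
      have a2 := habs j₀
      rw [e1, sub_zero, abs_of_nonneg (hψ0 _ _)] at a1 ⊢
      rw [e2, zero_sub, abs_neg, abs_of_nonneg (hψ0 _ _)] at a2 ⊢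
      rcases (hψ0 i₀ x).eq_or_lt with h | h
      · linarith
      rcases (hψ0 j₀ y).eq_or_lt with h' | h'
      · linarith
      have h1 := hpos _ _ h
      have h2 := hpos _ _ h'
      have h3 := N.dist_triangle (p i₀) x (p j₀)
      have h4 := N.dist_triangle x y (p j₀)
      have h5 := hsep i₀ j₀ hij
      rw [N.dist_comm y] at h4
      linarith
  have hvar : ∀ e ∈ S, ∑ i, variation (ψ i) e ≤ N.cost e := by
    intro e he
    have hadj := hS e he
    induction e with
    | _ x y => exact (hedge x y).trans (N.dist_le_cost hadj)
  have hball : ∀ i, c / 2 ≤ ∑ e ∈ S, variation (ψ i) e := by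
    intro i
    obtain ⟨j, hji⟩ := exists_ne i
    have h1 := abs_sub_le_sum_variation (ψ i) ((hj i).trans (hj j).symm)
    have e1 : ψ i (p i) = c / 2 := by
      simp only [hψ, N.dist_self, sub_zero]
      exact max_eq_right (by linarith)
    have e2 : ψ i (p j) = 0 := by
      have := hsep i j hji.symm
      exact max_eq_left (by linarith)
    rw [e1, e2, sub_zero, abs_of_pos (by linarith)] at h1
    exact h1
  have h1 : (Fintype.card ι : ℝ) * (c / 2) ≤ ∑ i, ∑ e ∈ S, variation (ψ i) e := by
    have := Finset.sum_le_sum fun i (_ : i ∈ Finset.univ) => hball i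
    simpa using this
  rw [Finset.sum_comm] at h1
  have h2 := Finset.sum_le_sum hvar
  linarith

/-! ### Optimal Steiner trees -/

theorem Joined.mono {S T : Finset (Sym2 V)} (h : S ⊆ T) {x y : V} (hj : Joined S x y) :
    Joined T x y :=
  SimpleGraph.Reachable.mono (SimpleGraph.fromEdgeSet_mono (by exact_mod_cast h)) hj

theorem Joined.exists_walk {S : Finset (Sym2 V)} (hS : ∀ e ∈ S, e ∈ N.graph.edgeSet) {x y : V}
    (hj : Joined S x y) : ∃ w : N.graph.Walk x y, ∀ e ∈ w.edges, e ∈ S := by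
  obtain ⟨w⟩ := hj
  have hle : SimpleGraph.fromEdgeSet (S : Set (Sym2 V)) ≤ N.graph := by
    intro a b hab
    exact hS _ ((SimpleGraph.fromEdgeSet_adj _).1 hab).1
  refine ⟨w.mapLe hle, fun e he => ?_⟩
  have he' : e ∈ w.edges := by simpa using he
  have := w.edges_subset_edgeSet he'
  rw [SimpleGraph.edgeSet_fromEdgeSet] at this
  exact this.1

theorem joined_of_walk {S : Finset (Sym2 V)} {x y : V} (w : N.graph.Walk x y)
    (hw : ∀ e ∈ w.edges, e ∈ S) : Joined S x y := by
  induction w with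
  | nil => exact SimpleGraph.Reachable.refl _
  | @cons a b c hadj w ih =>
    simp only [SimpleGraph.Walk.edges_cons, List.mem_cons, forall_eq_or_imp] at hw
    refine SimpleGraph.Reachable.trans (SimpleGraph.Adj.reachable ?_) (ih hw.2)
    exact (SimpleGraph.fromEdgeSet_adj _).2 ⟨hw.1, hadj.ne⟩

variable (N)

theorem exists_steinerOpt [Fintype V] (ρ : V) (T : Finset V) :
    ∃ S : Finset (Sym2 V), (∀ e ∈ S, e ∈ N.graph.edgeSet) ∧ (∀ x ∈ T, Joined S x ρ) ∧
      N.steinerOpt ρ T = ∑ e ∈ S, N.cost e := by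
  classical
  suffices N.steinerOpt ρ T ∈ {t : ℝ | ∃ S : Finset (Sym2 V), (∀ e ∈ S, e ∈ N.graph.edgeSet) ∧
      (∀ x ∈ T, Joined S x ρ) ∧ t = ∑ e ∈ S, N.cost e} from this
  refine Set.Nonempty.csInf_mem ?_ ((Set.finite_range fun S : Finset (Sym2 V) =>
    ∑ e ∈ S, N.cost e).subset ?_)
  · refine ⟨_, Finset.univ.filter fun e => e ∈ N.graph.edgeSet, by simp, fun x _ => ?_, rfl⟩
    obtain ⟨w⟩ := N.connected.preconnected x ρ
    exact joined_of_walk w fun e he => by simpa using w.edges_subset_edgeSet he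
  · rintro t ⟨S, -, -, rfl⟩
    exact ⟨S, rfl⟩

theorem steinerOpt_nonneg (ρ : V) (T : Finset V) : 0 ≤ N.steinerOpt ρ T := by
  refine Real.sInf_nonneg ?_
  rintro t ⟨S, -, -, rfl⟩
  exact Finset.sum_nonneg fun e _ => N.cost_nonneg e

/-! ### Greedy -/

variable {N}

theorem mem_newEdges {S : Finset (Sym2 V)} {x y : V} {w : N.graph.Walk x y} {e : Sym2 V} :
    e ∈ N.newEdges S w ↔ e ∈ w.edges ∧ e ∉ S := by
  simp [newEdges]

theorem exists_greedyStep [Fintype V] (ρ : V) (S : Finset (Sym2 V)) (x : V) :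
    ∃ S' g, N.GreedyStep ρ S x S' g := by
  classical
  obtain ⟨w₀⟩ := N.connected.preconnected x ρ
  -- There may be infinitely many walks, but only finitely many sets of new edges. Shortcutting a
  -- minimiser to a path adds no edges.
  obtain ⟨_, ⟨w, rfl⟩, hmin⟩ := Set.exists_min_image
    (Set.range fun w : N.graph.Walk x ρ => N.newEdges S w) (fun T => ∑ e ∈ T, N.cost e)
    (Set.toFinite _) ⟨_, w₀, rfl⟩
  refine ⟨S ∪ N.newEdges S w.bypass, _, w.bypass, w.bypass_isPath, fun w' => ?_,
    fun e => Finset.mem_union, rfl⟩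
  refine le_trans ?_ (hmin _ ⟨w', rfl⟩)
  refine Finset.sum_le_sum_of_subset_of_nonneg (fun e he => ?_) fun e _ _ => N.cost_nonneg e
  rw [mem_newEdges] at he ⊢
  exact ⟨w.edges_bypass_subset_edges he.1, he.2⟩

namespace GreedyStep

variable {ρ x : V} {S S' : Finset (Sym2 V)} {g : ℝ} (h : N.GreedyStep ρ S x S' g)
include h

theorem nonneg : 0 ≤ g := by
  obtain ⟨w, -, -, -, rfl⟩ := h
  exact Finset.sum_nonneg fun e _ => N.cost_nonneg e

theorem subset : S ⊆ S' := by
  obtain ⟨w, -, -, hS', rfl⟩ := h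
  exact fun e he => (hS' e).2 (Or.inl he)

theorem mem_edgeSet (hS : ∀ e ∈ S, e ∈ N.graph.edgeSet) : ∀ e ∈ S', e ∈ N.graph.edgeSet := by
  obtain ⟨w, -, -, hS', rfl⟩ := h
  intro e he
  rcases (hS' e).1 he with he | he
  · exact hS e he
  · exact w.edges_subset_edgeSet (mem_newEdges.1 he).1

theorem joined : Joined S' x ρ := by
  obtain ⟨w, -, -, hS', rfl⟩ := h
  refine joined_of_walk w fun e he => (hS' e).2 ?_
  by_cases heS : e ∈ S
  · exact Or.inl heS
  · exact Or.inr (mem_newEdges.2 ⟨he, heS⟩)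

theorem cost_le : ∑ e ∈ S', N.cost e ≤ ∑ e ∈ S, N.cost e + g := by
  classical
  obtain ⟨w, -, -, hS', rfl⟩ := h
  have : S' = S ∪ N.newEdges S w := by
    ext e
    rw [hS', Finset.mem_union]
  rw [this]
  exact Finset.sum_union_le_sum_add_sum _ _ N.cost_nonneg

/-- A shortest walk to `y` can be continued to the root inside `S` for free. -/
theorem le_dist (hS : ∀ e ∈ S, e ∈ N.graph.edgeSet) {y : V} (hy : Joined S y ρ) :
    g ≤ N.dist x y := by
  classical
  obtain ⟨w, -, hmin, -, rfl⟩ := h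
  obtain ⟨w₂, hw₂⟩ := hy.exists_walk hS
  refine N.le_dist fun w₁ => (hmin (w₁.append w₂)).trans
    (le_trans ?_ (List.sum_toFinset_le_sum_map w₁.edges N.cost_nonneg))
  refine Finset.sum_le_sum_of_subset_of_nonneg (fun e he => ?_) fun e _ _ => N.cost_nonneg e
  rw [mem_newEdges, SimpleGraph.Walk.edges_append, List.mem_append] at he
  rcases he with ⟨he | he, hne⟩
  · exact List.mem_toFinset.2 he
  · exact absurd (hw₂ e he) hne

theorem le_cost_tree {T : Finset (Sym2 V)} (hT : ∀ e ∈ T, e ∈ N.graph.edgeSet)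
    (hx : Joined T x ρ) : g ≤ ∑ e ∈ T, N.cost e := by
  obtain ⟨w, -, hmin, -, rfl⟩ := h
  obtain ⟨w₂, hw₂⟩ := hx.exists_walk hT
  exact (hmin w₂).trans (Finset.sum_le_sum_of_subset_of_nonneg
    (fun e he => hw₂ e (mem_newEdges.1 he).1) fun e _ _ => N.cost_nonneg e)

end GreedyStep

/-- Cost of Greedy for the terminals of one hyperedge whose root is already connected. -/
theorem sum_greedy_le [Fintype V] {n : ℕ} {r : Fin n → V} {A : Finset (Fin n)} {b : V}
    {g : Fin n → ℝ} (hb : ∀ i ∈ A, g i ≤ N.dist (r i) b)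
    (hr : ∀ i ∈ A, ∀ j ∈ A, j < i → g i ≤ N.dist (r i) (r j)) {T : Finset V}
    (hT : ∀ i ∈ A, r i ∈ T) :
    ∑ i ∈ A, g i ≤ 2 * N.steinerOpt b T * (harmonic A.card : ℝ) := by
  classical
  refine Finset.sum_le_mul_harmonic (by have := N.steinerOpt_nonneg b T; positivity) A ?_
  intro P hP hne c hc hg
  obtain ⟨S, hS, hj, hcost⟩ := N.exists_steinerOpt b T
  have : Nonempty P := hne.to_subtype
  -- The root `b` enters as the additional point `none`. Of two terminals the later one pays at most
  -- their distance, so all points are at distance at least `c`.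
  have key := card_mul_le_cost (N := N) (ι := Option P)
    (p := fun o => o.elim b fun i => r i) hc ?_ hS (ρ := b) ?_
  · rw [hcost]
    simpa using key
  · have hlt : ∀ i j : P, (j : Fin n) < i → c ≤ N.dist (r i) (r j) := fun i j hij =>
      (hg i i.2).trans (hr i (hP i.2) j (hP j.2) hij)
    rintro (_ | i) (_ | j) hij
    · exact absurd rfl hij
    · simp only [Option.elim]
      rw [N.dist_comm]
      exact (hg j j.2).trans (hb j (hP j.2))
    · exact (hg i i.2).trans (hb i (hP i.2))
    · simp only [Option.elim]
      rcases lt_trichotomy (i : Fin n) j with hlt' | heq | hlt'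
      · rw [N.dist_comm]
        exact hlt _ _ hlt'
      · exact absurd (congrArg some (Subtype.ext heq)) hij
      · exact hlt _ _ hlt'
  · rintro (_ | i)
    · exact SimpleGraph.Reachable.refl _
    · exact hj _ (hT i (hP i.2))

theorem greedy_phase_subset {ρ : V} {r : ℕ → V} {m n : ℕ} {c c' : Finset (Sym2 V)} {t : ℝ}
    {cs : ℕ → Finset (Sym2 V)} {g : ℕ → ℝ} (h : IsPhase (N.GreedyStep ρ) r m n c c' t cs g)
    {i j : ℕ} (hmi : m ≤ i) (hij : i ≤ j) (hjn : j ≤ n) : cs i ⊆ cs j := by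
  induction j, hij using Nat.le_induction with
  | base => exact subset_rfl
  | succ j hij ih => exact (ih (by omega)).trans (h.step j (by omega) (by omega)).subset

theorem greedy_phase_mem_edgeSet {ρ : V} {r : ℕ → V} {m n : ℕ} {c c' : Finset (Sym2 V)} {t : ℝ}
    {cs : ℕ → Finset (Sym2 V)} {g : ℕ → ℝ} (h : IsPhase (N.GreedyStep ρ) r m n c c' t cs g)
    (hc : ∀ e ∈ c, e ∈ N.graph.edgeSet) {j : ℕ} (hmj : m ≤ j) (hjn : j ≤ n) :
    ∀ e ∈ cs j, e ∈ N.graph.edgeSet := by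
  induction j, hmj using Nat.le_induction with
  | base => rwa [h.first]
  | succ j hij ih => exact (h.step j hij (by omega)).mem_edgeSet (ih (by omega))

/-- Cost of Greedy in a phase during which all predicted requests are connected. -/
theorem greedy_phase_le [Fintype V] {ρ : V} {R Rhat : List V} {m n : ℕ}
    {c c' : Finset (Sym2 V)} {t : ℝ} {cs : ℕ → Finset (Sym2 V)} {g : ℕ → ℝ}
    (h : IsPhase (N.GreedyStep ρ) (fun i => R.getD i ρ) m n c c' t cs g)
    (hc : ∀ e ∈ c, e ∈ N.graph.edgeSet) (hn : n ≤ R.length)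
    (hhat : ∀ i, Joined c (Rhat.get i) ρ) {k : ℕ}
    {H : Finset (Finset (Fin R.length) × Fin Rhat.length)} (hH : IsHyperedgeCover (k : ℕ∞) H) :
    t ≤ 2 * (1 + Real.log k) * sumCost (N.steinerγ R Rhat) H := by
  classical
  -- Costs are extended by zero beyond the phase, since the cover concerns all of `R`; the tree of a
  -- hyperedge still serves the terminals that fall into the phase.
  set a : ℕ → ℝ := fun i => if i ∈ Finset.Ico m n then g i else 0 with ha
  have ha0 : ∀ i, 0 ≤ a i := by
    intro i
    simp only [ha]
    split_ifs with hi
    · rw [Finset.mem_Ico] at hi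
      exact (h.step i hi.1 hi.2).nonneg
    · exact le_rfl
  have ht : t = ∑ i : Fin R.length, a i := by
    rw [← Finset.sum_range (f := a), h.total]
    simp only [ha]
    rw [Finset.sum_ite_mem, Finset.inter_eq_right.2]
    intro i hi
    simp at hi ⊢
    omega
  rw [ht, sumCost, Finset.mul_sum]
  refine (hH.sum_le fun i : Fin R.length => ha0 i).trans (Finset.sum_le_sum fun e he => ?_)
  have hsum : ∑ i ∈ e.1, a i = ∑ i ∈ e.1.filter fun i : Fin R.length => (i : ℕ) ∈ Finset.Ico m n, g i := by
    rw [Finset.sum_filter]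
  rw [hsum]
  have hdist : ∀ i, m ≤ i → i < n → ∀ y, Joined (cs i) y ρ → g i ≤ N.dist (R.getD i ρ) y :=
    fun i hmi hin y hy =>
      (h.step i hmi hin).le_dist (greedy_phase_mem_edgeSet h hc hmi hin.le) hy
  have hfc := h.first
  refine (sum_greedy_le (N := N) (r := R.get) (b := Rhat.get e.2) (T := e.1.image R.get)
    (fun i hi => ?_) (fun i hi j hj hji => ?_) (fun i hi => ?_)).trans ?_
  · simp only [Finset.mem_filter, Finset.mem_Ico] at hi
    have := hdist i hi.2.1 hi.2.2 _ ((hhat e.2).mono (hfc ▸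
      greedy_phase_subset h le_rfl hi.2.1 hi.2.2.le))
    simpa using this
  · simp only [Finset.mem_filter, Finset.mem_Ico] at hi hj
    have hlt : (j : ℕ) < i := hji
    have := hdist i hi.2.1 hi.2.2 _ ((h.step j hj.2.1 hj.2.2).joined.mono
      (greedy_phase_subset h (by omega) (by omega) hi.2.2.le))
    simpa using this
  · exact Finset.mem_image_of_mem _ (Finset.mem_filter.1 hi).1
  · have h1 := N.steinerOpt_nonneg (Rhat.get e.2) (e.1.image R.get)
    have h2 : (harmonic (e.1.filter fun i : Fin R.length => (i : ℕ) ∈ Finset.Ico m n).card : ℝ) ≤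
        1 + Real.log k :=
      harmonic_le_of_le ((Finset.card_filter_le _ _).trans (by exact_mod_cast hH.1 e he))
    have h3 := mul_le_mul_of_nonneg_left h2 h1
    simp only [steinerγ]
    linarith

/-- A solution of the predicted instance from a solution of the actual instance and a cover. -/
theorem exists_full_steiner [Fintype V] (ρ : V) {R : List V} (Rhat : List V)
    {X : Finset V} (hX : ∀ x ∈ R, x ∈ X) {H : Finset (Finset (Fin Rhat.length) × Fin R.length)} (hH : IsHyperedgeCover ⊤ H) :
    ∃ S, (N.steinerPC ρ Rhat).IsSol S ∧ (N.steinerPC ρ Rhat).unsat S = ∅ ∧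
      (N.steinerPC ρ Rhat).cost S ≤
        N.steinerOpt ρ X + sumCost (N.steinerγ Rhat R) H := by
  classical
  obtain ⟨T, hT, hTj, hTc⟩ := N.exists_steinerOpt ρ X
  choose F hF hFj hFc using fun h : Finset (Fin Rhat.length) × Fin R.length =>
    N.exists_steinerOpt (R.get h.2) (h.1.image Rhat.get)
  -- A prediction reaches a real request through the tree of its hyperedge, and from there the root
  -- through `T`.
  refine ⟨T ∪ H.biUnion F, fun e he => ?_, ?_, ?_⟩
  · rcases Finset.mem_union.1 he with he | he
    · exact hT e he
    · obtain ⟨h, -, he⟩ := Finset.mem_biUnion.1 he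
      exact hF h e he
  · simp only [steinerPC, Finset.filter_eq_empty_iff, not_not]
    intro i _
    obtain ⟨h, hh, hi⟩ := hH.2 i
    refine SimpleGraph.Reachable.trans
      (Joined.mono ?_ (hFj h _ (Finset.mem_image_of_mem _ hi)))
      (Joined.mono Finset.subset_union_left (hTj _ (hX _ (by simp))))
    exact (Finset.subset_biUnion_of_mem F hh).trans Finset.subset_union_right
  · have h1 : ∑ e ∈ T ∪ H.biUnion F, N.cost e ≤
        ∑ e ∈ T, N.cost e + ∑ e ∈ H.biUnion F, N.cost e :=
      Finset.sum_union_le_sum_add_sum _ _ N.cost_nonneg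
    have h2 : ∑ e ∈ H.biUnion F, N.cost e ≤ ∑ h ∈ H, ∑ e ∈ F h, N.cost e :=
      Finset.sum_biUnion_le_sum _ _ N.cost_nonneg
    simp only [steinerPC, sumCost, steinerγ, hTc]
    refine h1.trans (add_le_add le_rfl (h2.trans (Finset.sum_le_sum fun h _ => ?_)))
    rw [← hFc h]

/-! ### The learning-augmented algorithm for Steiner tree -/

theorem exists_run_steiner [Fintype V] {ν x₀ : ℝ} (hν : 1 ≤ ν) (ρ : V)
    (R Rhat : List V)
    {PC : (Fin Rhat.length → ℝ) → Finset (Sym2 V)} (hPC : (N.steinerPC ρ Rhat).IsApprox ν PC) :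
    ∃ s, Run (N.steinerAlg ρ Rhat) ν x₀ PC R s :=
  exists_run (A := N.steinerAlg ρ Rhat) hν hPC (S₀ := ∅) (by simp [steinerAlg, steinerPC])
    (by simp [steinerAlg, steinerPC]) (fun _ => True) trivial (fun _ _ _ => trivial)
    (fun _ _ _ _ _ _ => trivial) (fun c r _ => exists_greedyStep ρ c r)
    (fun _ _ _ _ h => h.nonneg) R

/-- Instance of `Run.last_le` where a single request costs at most OPT, and a phase with all
predictions connected at most 2(1 + log k) times the cost of the cover `H₂`. A set `X` stands for
the set of requests so that no decidability instance enters. -/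
theorem run_steiner_cost_le [Fintype V] {ν x₀ : ℝ} (hν : 1 ≤ ν) (hx : 0 < x₀)
    {ρ : V} {R Rhat : List V} {X : Finset V} (hX : ∀ x ∈ R, x ∈ X) {PC : (Fin Rhat.length → ℝ) → Finset (Sym2 V)}
    (hPC : (N.steinerPC ρ Rhat).IsApprox ν PC) {s : FrameworkState (Finset (Sym2 V))}
    (h : Run (N.steinerAlg ρ Rhat) ν x₀ PC R s) {k : ℕ}
    {H₁ : Finset (Finset (Fin Rhat.length) × Fin R.length)} (hH₁ : IsHyperedgeCover ⊤ H₁)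
    {H₂ : Finset (Finset (Fin R.length) × Fin Rhat.length)}
    (hH₂ : IsHyperedgeCover (k : ℕ∞) H₂) :
    ∑ e ∈ s.cfg, N.cost e ≤ (2 + 6 * ν) * (2 * N.steinerOpt ρ X +
      sumCost (N.steinerγ Rhat R) H₁ +
      4 * (1 + Real.log k) * sumCost (N.steinerγ R Rhat) H₂) := by
  classical
  have hlog := Real.log_natCast_nonneg k
  have hcost : ∀ S, 0 ≤ (N.steinerPC ρ Rhat).cost S :=
    fun S => Finset.sum_nonneg fun e _ => N.cost_nonneg e
  have hH₂0 : 0 ≤ sumCost (N.steinerγ R Rhat) H₂ :=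
    Finset.sum_nonneg fun e _ => N.steinerOpt_nonneg _ _
  obtain ⟨S, hS, hfull, hSc⟩ := exists_full_steiner (N := N) ρ Rhat hX hH₁
  obtain ⟨T, hT, hTj, hTc⟩ := N.exists_steinerOpt ρ X
  have h1 := h.cost_le hν (fun c => ∑ e ∈ c, N.cost e) (by simp [steinerAlg])
    (fun c r c' g hc => GreedyStep.cost_le hc) (fun c S => by
      simp only [steinerAlg, steinerPC]
      exact Finset.sum_union_le_sum_add_sum _ _ N.cost_nonneg) (fun _ _ _ _ h => GreedyStep.nonneg h)
  have h2 := h.last_le hν hx hPC hcost hS hfull (fun c => ∀ e ∈ c, e ∈ N.graph.edgeSet)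
    (fun _ => True) (by simp [steinerAlg]) trivial
    (fun c u hc e he => by
      rcases Finset.mem_union.1 he with he | he
      · exact hc e he
      · exact hPC.isSol_partialSol hx u e he)
    (fun _ _ => trivial) (fun c r c' g hc hg => GreedyStep.mem_edgeSet hg hc) R.length
    (fun i => R.getD i ρ) (N.steinerOpt_nonneg ρ X)
    (Y := 2 * (1 + Real.log k) * sumCost (N.steinerγ R Rhat) H₂) (by positivity)
    (fun m n c c' c'' t g₀ cs g hI _ hp hn hs => by
      have ht : 0 ≤ t := by
        rw [hp.total]
        refine Finset.sum_nonneg fun i hi => ?_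
        rw [Finset.mem_Ico] at hi
        exact GreedyStep.nonneg (hp.step i hi.1 hi.2)
      have := GreedyStep.le_cost_tree hs hT (hTj _ (hX _ (by
        rw [List.getD_eq_getElem _ _ hn]
        exact List.getElem_mem hn)))
      rw [hTc]
      linarith)
    (fun m n c c' t cs g S' hI hS' hu hc hI' hp hn => by
      refine greedy_phase_le hp hI' hn (fun i => ?_) hH₂
      have : i ∉ (N.steinerPC ρ Rhat).unsat S' := by
        have hu' : (N.steinerPC ρ Rhat).unsat S' = ∅ := hu
        simp [hu']
      simp only [steinerPC, Finset.mem_filter, Finset.mem_univ, true_and, not_not] at this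
      exact this.mono Finset.subset_union_right)
    le_rfl (fun i hi => by simp [hi])
  have h3 : (N.steinerAlg ρ Rhat).offline.cost S ≤ _ := hSc
  have h4 : s.last ≤ 2 * N.steinerOpt ρ X + sumCost (N.steinerγ Rhat R) H₁ +
      4 * (1 + Real.log k) * sumCost (N.steinerγ R Rhat) H₂ := by linarith
  have h5 := mul_le_mul_of_nonneg_left h4 (by linarith : 0 ≤ 2 + 6 * ν)
  linarith [h1.1, h1.2.2.2]

end Network

/-! ### Covers with a single covered element -/

section SplitCost

variable {A B : Type*}

open Classical in
/-- The hyperedges that are nonempty and whose endpoint in `B` does not cover exactly one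
element. -/
noncomputable def properEdges (H : Finset (Finset A × B)) : Finset (Finset A × B) :=
  H.filter fun h => (coveredBy H h.2).card ≠ 1 ∧ h.1.Nonempty

open Classical in
/-- Cost of a cover where an endpoint in `B` that covers exactly one element is charged only for
the distance `d`, and every other hyperedge for opening and for connecting at cost `κ`. -/
noncomputable def splitCost [Fintype B] (f : B → ℝ) (κ d : B → A → ℝ)
    (H : Finset (Finset A × B)) : ℝ :=
  ∑ b ∈ Finset.univ.filter (fun b => (coveredBy H b).card = 1), ∑ p ∈ coveredBy H b, d b p +
    ∑ h ∈ properEdges H, (f h.2 + ∑ p ∈ h.1, κ h.2 p)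

theorem mem_coveredBy {H : Finset (Finset A × B)} {b : B} {p : A} :
    p ∈ coveredBy H b ↔ ∃ h ∈ H, h.2 = b ∧ p ∈ h.1 := by
  simp [coveredBy, and_assoc]

theorem splitCost_nonneg [Fintype B] {f : B → ℝ} {κ d : B → A → ℝ} (hf : ∀ b, 0 ≤ f b)
    (hκ : ∀ b p, 0 ≤ κ b p) (hd : ∀ b p, 0 ≤ d b p) (H : Finset (Finset A × B)) :
    0 ≤ splitCost f κ d H :=
  add_nonneg (Finset.sum_nonneg fun b _ => Finset.sum_nonneg fun p _ => hd b p)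
    (Finset.sum_nonneg fun _ _ => add_nonneg (hf _) (Finset.sum_nonneg fun p _ => hκ _ p))

open Classical in
theorem IsHyperedgeCover.sum_le_split [Fintype A] [Fintype B] {k : ℕ∞}
    {H : Finset (Finset A × B)} (hH : IsHyperedgeCover k H) {a : A → ℝ} (ha : ∀ i, 0 ≤ a i) :
    ∑ i, a i ≤
      ∑ b ∈ Finset.univ.filter (fun b => (coveredBy H b).card = 1), ∑ p ∈ coveredBy H b, a p +
        ∑ h ∈ properEdges H, ∑ p ∈ h.1, a p := by
  have hsub : (Finset.univ : Finset A) ⊆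
      (Finset.univ.filter fun b => (coveredBy H b).card = 1).biUnion (coveredBy H) ∪
        (properEdges H).biUnion fun h => h.1 := by
    intro p _
    obtain ⟨h, hh, hp⟩ := hH.2 p
    by_cases hs : (coveredBy H h.2).card = 1
    · refine Finset.mem_union_left _ (Finset.mem_biUnion.2 ⟨h.2, by simpa using hs, ?_⟩)
      exact mem_coveredBy.2 ⟨h, hh, rfl, hp⟩
    · refine Finset.mem_union_right _ (Finset.mem_biUnion.2 ⟨h, ?_, hp⟩)
      exact Finset.mem_filter.2 ⟨hh, hs, p, hp⟩
  refine (Finset.sum_le_sum_of_subset_of_nonneg hsub fun i _ _ => ha i).trans ?_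
  refine (Finset.sum_union_le_sum_add_sum _ _ ha).trans ?_
  exact add_le_add (Finset.sum_biUnion_le_sum _ _ ha) (Finset.sum_biUnion_le_sum _ _ ha)

/-- For an endpoint that covers only p, some hyperedge contains p and its cost is at least the
opening cost plus the distance; deducting the opening cost leaves the distance. This subtraction
requires `hγd` with constant 1, whereas the other hyperedges may lose the factor `c` in `hγκ`. -/
theorem splitCost_le_refinedCost [Fintype B] {f : B → ℝ} {κ d : B → A → ℝ}
    {γ : Finset A → B → ℝ} {c : ℝ} (hc : 1 ≤ c) (hd : ∀ b p, 0 ≤ d b p)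
    (hγ : ∀ A' b, 0 ≤ γ A' b) (hγd : ∀ A' b, A'.Nonempty → f b + ∑ p ∈ A', d b p ≤ γ A' b)
    (hγκ : ∀ A' b, A'.Nonempty → f b + ∑ p ∈ A', κ b p ≤ c * γ A' b)
    (H : Finset (Finset A × B)) : splitCost f κ d H ≤ c * refinedCost f γ H := by
  classical
  have h1 : ∑ h ∈ H, γ h.1 h.2 = ∑ h ∈ H.filter (fun h => (coveredBy H h.2).card = 1), γ h.1 h.2 +
      ∑ h ∈ H.filter (fun h => ¬ (coveredBy H h.2).card = 1), γ h.1 h.2 :=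
    (Finset.sum_filter_add_sum_filter_not _ _ _).symm
  have h2 : ∑ h ∈ properEdges H, (f h.2 + ∑ p ∈ h.1, κ h.2 p) ≤
      c * ∑ h ∈ H.filter (fun h => ¬ (coveredBy H h.2).card = 1), γ h.1 h.2 := by
    rw [Finset.mul_sum]
    refine (Finset.sum_le_sum fun h hh => ?_).trans
      (Finset.sum_le_sum_of_subset_of_nonneg (s := properEdges H)
        (f := fun h => c * γ h.1 h.2) ?_ fun h _ _ => ?_)
    · exact hγκ _ _ (Finset.mem_filter.1 hh).2.2
    · intro h hh
      have := Finset.mem_filter.1 hh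
      exact Finset.mem_filter.2 ⟨this.1, this.2.1⟩
    · exact mul_nonneg (by linarith) (hγ _ _)
  have h3 : ∑ b ∈ Finset.univ.filter (fun b => (coveredBy H b).card = 1),
      (f b + ∑ p ∈ coveredBy H b, d b p) ≤
        ∑ h ∈ H.filter (fun h => (coveredBy H h.2).card = 1), γ h.1 h.2 := by
    rw [← Finset.sum_fiberwise_of_maps_to (g := Prod.snd)
      (t := Finset.univ.filter fun b => (coveredBy H b).card = 1)
      (fun h hh => by simpa using (Finset.mem_filter.1 hh).2)]
    refine Finset.sum_le_sum fun b hb => ?_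
    have hb1 := (Finset.mem_filter.1 hb).2
    obtain ⟨p, hp⟩ := Finset.card_eq_one.1 hb1
    obtain ⟨h, hh, rfl, hph⟩ := mem_coveredBy.1 (hp ▸ Finset.mem_singleton_self p)
    rw [hp, Finset.sum_singleton]
    have i1 : d h.2 p ≤ ∑ q ∈ h.1, d h.2 q :=
      Finset.single_le_sum (fun q _ => hd h.2 q) hph
    have i2 := hγd h.1 h.2 ⟨p, hph⟩
    have i3 := Finset.single_le_sum (f := fun e : Finset A × B => γ e.1 e.2)
      (fun e _ => hγ e.1 e.2)
      (show h ∈ (H.filter fun e => (coveredBy H e.2).card = 1).filter fun e => e.2 = h.2 by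
        simp [hh, hb1])
    linarith
  rw [Finset.sum_add_distrib] at h3
  have h4 : 0 ≤ ∑ b ∈ Finset.univ.filter (fun b => (coveredBy H b).card = 1),
      ∑ p ∈ coveredBy H b, d b p :=
    Finset.sum_nonneg fun b _ => Finset.sum_nonneg fun p _ => hd b p
  unfold splitCost refinedCost sumCost
  rw [h1]
  nlinarith

end SplitCost

/-- A system of inequalities as satisfied by the dual variables of the clients of one facility. -/
theorem Finset.sum_le_of_rank_le {a κ : ℕ → ℝ} {F : ℝ} (hκ : ∀ i, 0 ≤ κ i) (P : Finset ℕ)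
    (h : ∀ i ∈ P, ∀ Q ⊆ P, (∀ l ∈ Q, l < i) →
      ((Q.card : ℝ) + 1) * a i ≤ F + ((Q.card : ℝ) + 1) * κ i + 2 * ∑ l ∈ Q, κ l) :
    ∑ i ∈ P, a i ≤ (harmonic P.card : ℝ) * F + (1 + 2 * (harmonic P.card : ℝ)) * ∑ i ∈ P, κ i := by
  classical
  induction P using Finset.induction_on_max with
  | empty => simp
  | insert M P hM ih =>
    have hMP : M ∉ P := fun hmem => lt_irrefl _ (hM M hmem)
    have h1 := ih fun i hi Q hQ => h i (Finset.mem_insert_of_mem hi) Q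
      (hQ.trans (Finset.subset_insert _ _))
    -- The largest index is compared with all others; division by their number plus one yields the
    -- next term of the harmonic sum.
    have h2 := h M (Finset.mem_insert_self _ _) P (Finset.subset_insert _ _) hM
    rw [Finset.sum_insert hMP, Finset.sum_insert hMP, Finset.card_insert_of_notMem hMP,
      harmonic_succ]
    push_cast
    have hn : (0 : ℝ) < (P.card : ℝ) + 1 := by positivity
    set q : ℝ := ((P.card : ℝ) + 1)⁻¹ with hq
    have hq0 : 0 < q := inv_pos.2 hn
    have h3 : a M ≤ q * F + κ M + 2 * q * ∑ l ∈ P, κ l := by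
      have := mul_le_mul_of_nonneg_left h2 hq0.le
      rw [← mul_assoc, hq, inv_mul_cancel₀ hn.ne', one_mul, mul_add, mul_add, ← mul_assoc _ _ (κ M),
        inv_mul_cancel₀ hn.ne', one_mul, ← hq] at this
      linarith
    have hH : (0 : ℝ) ≤ (harmonic P.card : ℝ) := by
      rw [harmonic]
      push_cast
      positivity
    have h4 := mul_nonneg hH (hκ M)
    have h5 := mul_nonneg hq0.le (hκ M)
    linarith

/-! ### The primal-dual algorithm and its dual variables -/

namespace Facility

variable {V : Type u} {f : V → ℝ} {κ d : V → V → ℝ}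

/-- Connection costs `κ` for facilities and clients in a space with distance `d`. -/
structure IsConnectionCost (κ d : V → V → ℝ) : Prop where
  nonneg : ∀ x y, 0 ≤ d x y
  comm : ∀ x y, d x y = d y x
  triangle : ∀ x y z, d x z ≤ d x y + d y z
  le : ∀ v x, d v x ≤ κ v x
  le_add : ∀ v x y, κ v x ≤ κ v y + d y x

theorem IsConnectionCost.cost_nonneg (h : IsConnectionCost κ d) (v x : V) : 0 ≤ κ v x :=
  (h.nonneg v x).trans (h.le v x)

theorem toSet_le {F : Finset V} {z : V} (hz : z ∈ F) (x : V) : toSet κ F x ≤ κ z x := by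
  rw [toSet, dif_pos ⟨z, hz⟩]
  exact Finset.inf'_le _ hz

theorem exists_toSet_eq {F : Finset V} (hF : F.Nonempty) (x : V) :
    ∃ v ∈ F, toSet κ F x = κ v x := by
  rw [toSet, dif_pos hF]
  exact Finset.exists_mem_eq_inf' hF _

theorem exists_isClosest {F : Finset V} (hF : F.Nonempty) (x : V) : ∃ v, IsClosest κ F x v := by
  obtain ⟨v, hv, h⟩ := exists_toSet_eq (κ := κ) hF x
  exact ⟨v, hv, fun z hz => h ▸ toSet_le hz x⟩

theorem IsClosest.toSet_eq {F : Finset V} {x v : V} (h : IsClosest κ F x v) :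
    toSet κ F x = κ v x := by
  refine le_antisymm (toSet_le h.1 x) ?_
  obtain ⟨w, hw, he⟩ := exists_toSet_eq (κ := κ) ⟨v, h.1⟩ x
  rw [he]
  exact h.2 w hw

theorem toSet_anti {F F' : Finset V} (hF : F.Nonempty) (h : F ⊆ F') (x : V) :
    toSet κ F' x ≤ toSet κ F x := by
  obtain ⟨w, hw, he⟩ := exists_toSet_eq (κ := κ) hF x
  rw [he]
  exact toSet_le (h hw) x

theorem toSet_nonneg (hκ : ∀ v x, 0 ≤ κ v x) (F : Finset V) (x : V) : 0 ≤ toSet κ F x := by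
  rcases F.eq_empty_or_nonempty with rfl | hF
  · simp [toSet]
  · obtain ⟨w, -, he⟩ := exists_toSet_eq (κ := κ) hF x
    rw [he]
    exact hκ w x

theorem potential_nonneg (s : Config V) (z : V) : 0 ≤ potential κ s z :=
  List.sum_nonneg (by simp)

theorem exists_step [Fintype V] [Nonempty V] (hf : ∀ v, 0 ≤ f v) (s : Config V) (x : V) :
    ∃ s' g, Step f κ s x s' g := by
  classical
  obtain ⟨w, -, hw⟩ := Finset.exists_min_image Finset.univ (threshold f κ s x)
    Finset.univ_nonempty
  have hmin : ∀ z, threshold f κ s x w ≤ threshold f κ s x z := fun z => hw z (Finset.mem_univ z)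
  obtain ⟨v', hv'⟩ := exists_isClosest (κ := κ) (Finset.insert_nonempty w s.opened) x
  rcases s.opened.eq_empty_or_nonempty with h0 | hne
  · exact ⟨_, _, Step.add w v' (by simp [h0]) hmin (by simp [h0]) hv'⟩
  obtain ⟨v, hv⟩ := exists_isClosest (κ := κ) hne x
  by_cases hle : ∀ z, κ v x ≤ threshold f κ s x z
  · exact ⟨_, _, Step.stay v hv hle⟩
  push Not at hle
  obtain ⟨z, hz⟩ := hle
  have hlt : threshold f κ s x w < κ v x := (hmin z).trans_lt hz
  refine ⟨_, _, Step.add w v' (fun hmem => ?_) hmin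
    (fun y hy => hlt.le.trans (hv.2 y hy)) hv'⟩
  -- An open facility has no potential, so its threshold is at least its connection cost and cannot
  -- be below the distance to the closest open facility.
  have hpot : potential κ s w = 0 := by
    have : ∀ y, max 0 (toSet κ s.opened y - κ w y) = 0 := fun y =>
      max_eq_left (sub_nonpos.2 (toSet_le hmem y))
    simp [potential, this]
  have h1 := hv.2 w hmem
  have h2 := hf w
  rw [threshold, hpot] at hlt
  linarith

/-- Cost for connecting the clients that arrived since the latest restart to the closest open
facilities. -/
noncomputable def reconnection (κ : V → V → ℝ) (s : Config V) : ℝ :=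
  (s.clients.map (toSet κ s.opened)).sum

/-- Invariant of the primal-dual algorithm: no facility is overpaid. -/
structure IsFeasible (f : V → ℝ) (κ : V → V → ℝ) (s : Config V) : Prop where
  nonempty : ∀ y ∈ s.clients, s.opened.Nonempty
  potential_le : ∀ z, potential κ s z ≤ f z

/-- `a` is the dual variable of client `x` in a step of the primal-dual algorithm. -/
structure IsDual (f : V → ℝ) (κ : V → V → ℝ) (s : Config V) (x : V) (s' : Config V) (g a : ℝ) :
    Prop where
  nonneg : 0 ≤ a
  le_threshold : ∀ z, a ≤ threshold f κ s x z
  le_cost : ∀ z ∈ s.opened, a ≤ κ z x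
  cost_add_le : g + reconnection κ s' ≤ reconnection κ s + 2 * a
  reconnection_le : reconnection κ s' ≤ reconnection κ s + g
  feasible : IsFeasible f κ s'
  opened_subset : s.opened ⊆ s'.opened
  opened_nonempty : s'.opened.Nonempty
  clients_eq : s'.clients = x :: s.clients

theorem Step.cost_nonneg (hf : ∀ v, 0 ≤ f v) (hκ : ∀ v x, 0 ≤ κ v x) {s s' : Config V} {x : V}
    {g : ℝ} (h : Step f κ s x s' g) : 0 ≤ g := by
  cases h with
  | stay v => exact hκ v x
  | add w v => exact add_nonneg (hf w) (hκ v x)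

/-- The dual variable is the value at which raising stops: the connection cost or the smallest
threshold. It is counted twice in `cost_add_le`, once for the current cost and once as a reserve,
the reconnection cost. A new facility is paid for by its threshold and by the drop of the reserve,
which is at least its potential. -/
theorem Step.exists_isDual (hf : ∀ v, 0 ≤ f v) (hκ : ∀ v x, 0 ≤ κ v x) {s s' : Config V} {x : V}
    {g : ℝ} (hs : IsFeasible f κ s) (h : Step f κ s x s' g) : ∃ a, IsDual f κ s x s' g a := by
  classical
  cases h with
  | stay v hv hle =>
    refine ⟨κ v x, hκ v x, hle, hv.2, ?_, ?_, ⟨fun _ _ => ⟨v, hv.1⟩, fun z => ?_⟩, subset_rfl,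
      ⟨v, hv.1⟩, rfl⟩
    · simp only [reconnection, List.map_cons, List.sum_cons, hv.toSet_eq]
      linarith
    · simp only [reconnection, List.map_cons, List.sum_cons, hv.toSet_eq]
      linarith
    · have h1 := hle z
      have h2 := hs.potential_le z
      simp only [potential, threshold, List.map_cons, List.sum_cons, hv.toSet_eq] at h1 h2 ⊢
      rcases max_cases 0 (κ v x - κ z x) with h | h <;> linarith
  | add w v hw hmin hle hv =>
    have hanti : ∀ y ∈ s.clients, toSet κ (insert w s.opened) y ≤ toSet κ s.opened y :=
      fun y hy => toSet_anti (hs.nonempty y hy) (Finset.subset_insert _ _) y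
    have hvw : κ v x ≤ κ w x := hv.2 w (Finset.mem_insert_self _ _)
    have hpw := hs.potential_le w
    have hgain : potential κ s w + (s.clients.map (toSet κ (insert w s.opened))).sum ≤
        reconnection κ s := by
      rw [potential, reconnection, ← List.sum_map_add]
      refine List.sum_le_sum fun y hy => ?_
      have h1 := hanti y hy
      have h2 : toSet κ (insert w s.opened) y ≤ κ w y :=
        toSet_le (Finset.mem_insert_self _ _) y
      rcases max_cases 0 (toSet κ s.opened y - κ w y) with h | h <;> linarith
    have hp0 := potential_nonneg (κ := κ) s w
    refine ⟨threshold f κ s x w, ?_, hmin, hle, ?_, ?_,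
      ⟨fun _ _ => ⟨w, Finset.mem_insert_self _ _⟩, fun z => ?_⟩, Finset.subset_insert _ _,
      ⟨w, Finset.mem_insert_self _ _⟩, rfl⟩
    · have := hκ w x
      rw [threshold]
      linarith
    · simp only [reconnection, List.map_cons, List.sum_cons, hv.toSet_eq, threshold] at hgain ⊢
      linarith
    · have := hf w
      simp only [reconnection, List.map_cons, List.sum_cons, hv.toSet_eq] at hgain ⊢
      linarith
    · have h1 := hmin z
      have h2 := hs.potential_le z
      have h3 : (s.clients.map fun y => max 0 (toSet κ (insert w s.opened) y - κ z y)).sum ≤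
          potential κ s z :=
        List.sum_le_sum fun y hy => max_le_max le_rfl (by linarith [hanti y hy])
      rw [threshold, threshold] at h1
      rw [potential]
      simp only [List.map_cons, List.sum_cons, hv.toSet_eq]
      rcases max_cases 0 (κ v x - κ z x) with h | h <;> linarith

/-! ### Phases of the primal-dual algorithm -/

theorem isFeasible_of_clients_eq_nil (hf : ∀ v, 0 ≤ f v) {s : Config V} (hs : s.clients = []) :
    IsFeasible f κ s :=
  ⟨by simp [hs], fun z => by simpa [potential, hs] using hf z⟩

section Phase

variable {r : ℕ → V} {m n : ℕ} {c c' : Config V} {t : ℝ} {cs : ℕ → Config V} {g : ℕ → ℝ}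

theorem exists_duals (hf : ∀ v, 0 ≤ f v) (hκ : ∀ v x, 0 ≤ κ v x) (hc : c.clients = [])
    (h : IsPhase (Step f κ) r m n c c' t cs g) :
    (∀ i, m ≤ i → i ≤ n → IsFeasible f κ (cs i)) ∧
      ∃ a : ℕ → ℝ, ∀ i, m ≤ i → i < n → IsDual f κ (cs i) (r i) (cs (i + 1)) (g i) (a i) := by
  have hfeas : ∀ i, m ≤ i → i ≤ n → IsFeasible f κ (cs i) := by
    intro i hmi
    induction i, hmi using Nat.le_induction with
    | base => exact fun _ => h.first ▸ isFeasible_of_clients_eq_nil hf hc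
    | succ i hmi ih =>
      intro hin
      obtain ⟨a, ha⟩ := (h.step i hmi (by omega)).exists_isDual hf hκ (ih (by omega))
      exact ha.feasible
  refine ⟨hfeas, ?_⟩
  have : ∀ i, ∃ a, m ≤ i → i < n → IsDual f κ (cs i) (r i) (cs (i + 1)) (g i) a := by
    intro i
    by_cases hi : m ≤ i ∧ i < n
    · obtain ⟨a, ha⟩ := (h.step i hi.1 hi.2).exists_isDual hf hκ (hfeas i hi.1 hi.2.le)
      exact ⟨a, fun _ _ => ha⟩
    · exact ⟨0, fun h1 h2 => absurd ⟨h1, h2⟩ hi⟩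
  choose a ha using this
  exact ⟨a, ha⟩

variable {a : ℕ → ℝ} (h : IsPhase (Step f κ) r m n c c' t cs g) (hc : c.clients = [])
  (ha : ∀ i, m ≤ i → i < n → IsDual f κ (cs i) (r i) (cs (i + 1)) (g i) (a i))
include ha

theorem phase_opened_subset {i j : ℕ} (hmi : m ≤ i) (hij : i ≤ j) (hjn : j ≤ n) :
    (cs i).opened ⊆ (cs j).opened := by
  induction j, hij using Nat.le_induction with
  | base => exact subset_rfl
  | succ j hij ih => exact (ih (by omega)).trans (ha j (by omega) (by omega)).opened_subset

include h hc

theorem phase_clients_sum (φ : V → ℝ) {j : ℕ} (hmj : m ≤ j) (hjn : j ≤ n) :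
    ((cs j).clients.map φ).sum = ∑ i ∈ Finset.Ico m j, φ (r i) := by
  induction j, hmj using Nat.le_induction with
  | base => simp [h.first, hc]
  | succ j hmj ih =>
    rw [(ha j hmj (by omega)).clients_eq, List.map_cons, List.sum_cons, ih (by omega),
      Finset.sum_Ico_succ_top hmj, add_comm]

theorem phase_reconnection_le {j : ℕ} (hmj : m ≤ j) (hjn : j ≤ n) :
    reconnection κ (cs j) ≤ ∑ i ∈ Finset.Ico m j, g i := by
  induction j, hmj using Nat.le_induction with
  | base => simp [h.first, reconnection, hc]
  | succ j hmj ih =>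
    rw [Finset.sum_Ico_succ_top hmj]
    have := (ha j hmj (by omega)).reconnection_le
    have := ih (by omega)
    linarith

/-- Amortisation with the reconnection cost as potential function: it is zero after a restart and
never negative. -/
theorem phase_cost_le_duals (hκ : ∀ v x, 0 ≤ κ v x) : t ≤ 2 * ∑ i ∈ Finset.Ico m n, a i := by
  have key : ∀ j, m ≤ j → j ≤ n →
      ∑ i ∈ Finset.Ico m j, g i + reconnection κ (cs j) ≤ 2 * ∑ i ∈ Finset.Ico m j, a i := by
    intro j hmj
    induction j, hmj using Nat.le_induction with
    | base => simp [h.first, reconnection, hc]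
    | succ j hmj ih =>
      intro hjn
      rw [Finset.sum_Ico_succ_top hmj, Finset.sum_Ico_succ_top hmj]
      have := (ha j hmj (by omega)).cost_add_le
      have := ih (by omega)
      linarith
  have h1 := key n h.le le_rfl
  have h2 : 0 ≤ reconnection κ (cs n) :=
    List.sum_nonneg (by simpa using fun y _ => toSet_nonneg hκ _ y)
  rw [h.total]
  linarith

/-- Dual variables of the clients of one facility `b`. -/
theorem phase_cluster_le (hκ : IsConnectionCost κ d) (b : V) {P : Finset ℕ}
    (hP : P ⊆ Finset.Ico m n) :
    ∑ i ∈ P, a i ≤ (harmonic P.card : ℝ) * f b +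
      (1 + 2 * (harmonic P.card : ℝ)) * ∑ i ∈ P, κ b (r i) := by
  refine Finset.sum_le_of_rank_le (κ := fun i => κ b (r i)) (fun i => hκ.cost_nonneg _ _) P ?_
  intro i hi Q hQ hlt
  have hi' := Finset.mem_Ico.1 (hP hi)
  have hd := ha i hi'.1 hi'.2
  have hsub : Q ⊆ Finset.Ico m i := fun l hl =>
    Finset.mem_Ico.2 ⟨(Finset.mem_Ico.1 (hP (hQ hl))).1, hlt l hl⟩
  -- The dual variable of `i` is at most its distance to each open facility. By the detour through
  -- `b`, no earlier client `l` is much closer to one, so `l` bids for `b` almost as much.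
  have hpot : ∑ l ∈ Q, (a i - 2 * κ b (r l) - κ b (r i)) ≤ potential κ (cs i) b := by
    rw [potential, phase_clients_sum h hc ha _ hi'.1 hi'.2.le]
    refine (Finset.sum_le_sum fun l hl => ?_).trans
      (Finset.sum_le_sum_of_subset_of_nonneg hsub fun _ _ _ => le_max_left _ _)
    refine le_trans ?_ (le_max_right _ _)
    have hl' := Finset.mem_Ico.1 (hsub hl)
    -- `toSet` is zero on the empty set, so the lower bound on it needs an open facility; the step
    -- that served `l` left one.
    have hne : (cs i).opened.Nonempty :=
      (ha l hl'.1 (by omega)).opened_nonempty.mono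
        (phase_opened_subset ha (by omega) hl'.2 hi'.2.le)
    obtain ⟨v, hv, he⟩ := exists_toSet_eq (κ := κ) hne (r l)
    rw [he]
    have h1 := hd.le_cost v hv
    have h2 := hκ.le_add v (r i) (r l)
    have h3 := hκ.triangle (r l) b (r i)
    have h4 := hκ.le b (r i)
    have h5 := hκ.le b (r l)
    rw [hκ.comm (r l) b] at h3
    linarith
  have hth := hd.le_threshold b
  rw [threshold] at hth
  rw [Finset.sum_sub_distrib, Finset.sum_sub_distrib, Finset.sum_const, Finset.sum_const,
    ← Finset.mul_sum, nsmul_eq_mul, nsmul_eq_mul] at hpot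
  linarith

/-- Cost of the primal-dual algorithm in a phase that starts with an open facility `v j` for every
predicted client `j`. -/
theorem facility_phase_le (hf : ∀ v, 0 ≤ f v) (hκ : IsConnectionCost κ d) {R Rhat : List V}
    (hr : ∀ i : Fin R.length, r i = R.get i) (hn : n ≤ R.length) {v : Fin Rhat.length → V}
    (hv : ∀ j, v j ∈ c.opened) {k : ℕ}
    {H : Finset (Finset (Fin R.length) × Fin Rhat.length)} (hH : IsHyperedgeCover (k : ℕ∞) H) :
    t ≤ 2 * ∑ j, κ (v j) (Rhat.get j) + 6 * (1 + Real.log k) *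
      splitCost (fun b => f (Rhat.get b)) (fun b p => κ (Rhat.get b) (R.get p))
        (fun b p => d (Rhat.get b) (R.get p)) H := by
  classical
  have hlog := Real.log_natCast_nonneg k
  have hκ0 := hκ.cost_nonneg
  set a' : ℕ → ℝ := fun i => if i ∈ Finset.Ico m n then a i else 0 with ha'
  have ha0 : ∀ i, 0 ≤ a' i := by
    intro i
    simp only [ha']
    split_ifs with hi
    · rw [Finset.mem_Ico] at hi
      exact (ha i hi.1 hi.2).nonneg
    · exact le_rfl
  have hsum : ∑ i ∈ Finset.Ico m n, a i = ∑ i : Fin R.length, a' i := by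
    rw [← Finset.sum_range (f := a')]
    simp only [ha']
    rw [Finset.sum_ite_mem, Finset.inter_eq_right.2]
    intro i hi
    simp at hi ⊢
    omega
  have h1 := phase_cost_le_duals h hc ha hκ0
  rw [hsum] at h1
  have h2 := hH.sum_le_split fun i : Fin R.length => ha0 i
  -- A singly covered client could go to the prediction `b` and on to `v b`. Each `b` occurs once,
  -- so these continuations are paid by the connection cost of the bought solution.
  have h3 : ∑ b ∈ Finset.univ.filter (fun b => (coveredBy H b).card = 1),
      ∑ p ∈ coveredBy H b, a' p ≤
      ∑ b ∈ Finset.univ.filter (fun b => (coveredBy H b).card = 1),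
        ∑ p ∈ coveredBy H b, d (Rhat.get b) (R.get p) + ∑ j, κ (v j) (Rhat.get j) := by
    have h4 : ∑ b ∈ Finset.univ.filter (fun b => (coveredBy H b).card = 1),
        κ (v b) (Rhat.get b) ≤ ∑ j, κ (v j) (Rhat.get j) :=
      Finset.sum_le_sum_of_subset_of_nonneg (Finset.filter_subset _ _) fun j _ _ => hκ0 _ _
    refine le_trans ?_ (add_le_add le_rfl h4)
    rw [← Finset.sum_add_distrib]
    refine Finset.sum_le_sum fun b hb => ?_
    obtain ⟨p, hp⟩ := Finset.card_eq_one.1 (Finset.mem_filter.1 hb).2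
    rw [hp, Finset.sum_singleton, Finset.sum_singleton]
    simp only [ha']
    split_ifs with hi
    · rw [Finset.mem_Ico] at hi
      have h5 := (ha p hi.1 hi.2).le_cost (v b)
        (phase_opened_subset ha le_rfl hi.1 hi.2.le (h.first ▸ hv b))
      have h6 := hκ.le_add (v b) (R.get p) (Rhat.get b)
      rw [hr p] at h5
      linarith
    · exact add_nonneg (hκ.nonneg _ _) (hκ0 _ _)
  -- The 3 comes from 1 + 2h ≤ 3(1 + log k) for the harmonic number h of the clients in the phase.
  have h4 : ∑ e ∈ properEdges H, ∑ p ∈ e.1, a' p ≤ 3 * (1 + Real.log k) *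
      ∑ e ∈ properEdges H, (f (Rhat.get e.2) + ∑ p ∈ e.1, κ (Rhat.get e.2) (R.get p)) := by
    rw [Finset.mul_sum]
    refine Finset.sum_le_sum fun e he => ?_
    set Q : Finset (Fin R.length) := e.1.filter fun i : Fin R.length => (i : ℕ) ∈ Finset.Ico m n
    have h5 : ∑ p ∈ e.1, a' p = ∑ i ∈ Q.map Fin.valEmbedding, a i := by
      rw [Finset.sum_map, Finset.sum_filter]
      rfl
    have h6 := phase_cluster_le h hc ha hκ (Rhat.get e.2) (P := Q.map Fin.valEmbedding) (by
      intro i hi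
      obtain ⟨j, hj, rfl⟩ := Finset.mem_map.1 hi
      exact (Finset.mem_filter.1 hj).2)
    rw [← h5, Finset.card_map, Finset.sum_map] at h6
    have h7 : ∑ i ∈ Q, κ (Rhat.get e.2) (r (Fin.valEmbedding i)) ≤
        ∑ p ∈ e.1, κ (Rhat.get e.2) (R.get p) := by
      refine (Finset.sum_le_sum fun i _ => ?_).trans
        (Finset.sum_le_sum_of_subset_of_nonneg (Finset.filter_subset _ _) fun i _ _ => hκ0 _ _)
      exact (congrArg _ (hr i)).le
    have h8 : (harmonic Q.card : ℝ) ≤ 1 + Real.log k :=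
      harmonic_le_of_le ((Finset.card_filter_le _ _).trans
        (by exact_mod_cast hH.1 e (Finset.mem_filter.1 he).1))
    have h9 : (0 : ℝ) ≤ ∑ i ∈ Q, κ (Rhat.get e.2) (r (Fin.valEmbedding i)) :=
      Finset.sum_nonneg fun _ _ => hκ0 _ _
    have hH0 : (0 : ℝ) ≤ (harmonic Q.card : ℝ) := by
      rw [harmonic]
      push_cast
      positivity
    have hfb := hf (Rhat.get e.2)
    calc _ ≤ _ := h6
      _ ≤ (1 + Real.log k) * f (Rhat.get e.2) + (1 + 2 * (1 + Real.log k)) *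
            ∑ p ∈ e.1, κ (Rhat.get e.2) (R.get p) := by gcongr
      _ ≤ _ := by nlinarith [mul_nonneg hlog hfb, mul_nonneg hlog (h9.trans h7)]
  have h5 : 0 ≤ ∑ b ∈ Finset.univ.filter (fun b => (coveredBy H b).card = 1),
      ∑ p ∈ coveredBy H b, d (Rhat.get b) (R.get p) :=
    Finset.sum_nonneg fun b _ => Finset.sum_nonneg fun p _ => hκ.nonneg _ _
  have h6 := mul_nonneg hlog h5
  unfold splitCost
  linarith

end Phase

/-! ### Offline solutions -/

theorem opt_bddBelow (hf : ∀ v, 0 ≤ f v) (hκ : ∀ v x, 0 ≤ κ v x) (R : List V) :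
    BddBelow {t : ℝ | ∃ (F : Finset V) (a : Fin R.length → V), (∀ i, a i ∈ F) ∧
      t = ∑ v ∈ F, f v + ∑ i, κ (a i) (R.get i)} := by
  refine ⟨0, ?_⟩
  rintro _ ⟨F, a, -, rfl⟩
  exact add_nonneg (Finset.sum_nonneg fun v _ => hf v) (Finset.sum_nonneg fun i _ => hκ _ _)

theorem exists_opt [Fintype V] [Nonempty V] (f : V → ℝ) (κ : V → V → ℝ) (R : List V) :
    ∃ (F : Finset V) (a : Fin R.length → V), (∀ i, a i ∈ F) ∧
      opt f κ R = ∑ v ∈ F, f v + ∑ i, κ (a i) (R.get i) := by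
  classical
  suffices opt f κ R ∈ {t : ℝ | ∃ (F : Finset V) (a : Fin R.length → V), (∀ i, a i ∈ F) ∧
      t = ∑ v ∈ F, f v + ∑ i, κ (a i) (R.get i)} from this
  refine Set.Nonempty.csInf_mem ⟨_, Finset.univ, fun _ => Classical.arbitrary V, by simp, rfl⟩
    ((Set.finite_range fun p : Finset V × (Fin R.length → V) =>
      ∑ v ∈ p.1, f v + ∑ i, κ (p.2 i) (R.get i)).subset ?_)
  rintro _ ⟨F, a, -, rfl⟩
  exact ⟨(F, a), rfl⟩

/-- A solution of the predicted instance from a solution of the actual instance and a cover. -/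
theorem exists_full_pc [Fintype V] [Nonempty V] (hf : ∀ v, 0 ≤ f v) (hκ : IsConnectionCost κ d)
    (R Rhat : List V) {H : Finset (Finset (Fin Rhat.length) × Fin R.length)}
    (hH : IsHyperedgeCover ⊤ H) :
    ∃ S, (pc f κ Rhat).IsSol S ∧ (pc f κ Rhat).unsat S = ∅ ∧
      (pc f κ Rhat).cost S ≤ opt f κ R +
        splitCost (fun b => f (R.get b)) (fun b p => κ (R.get b) (Rhat.get p))
          (fun b p => d (R.get b) (Rhat.get p)) H := by
  classical
  have hκ0 := hκ.cost_nonneg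
  obtain ⟨F, a, haF, hopt⟩ := exists_opt f κ R
  -- Endpoints of a single prediction get no facility; their prediction uses the facility that
  -- serves the endpoint in the optimal solution. A covered prediction has an endpoint among the
  -- requests, so `F` is nonempty when needed.
  set F' : Finset V := F ∪ (properEdges H).biUnion fun h => {R.get h.2} with hF'
  have hne : ∀ p : Fin Rhat.length, ∃ v, IsClosest κ F' (Rhat.get p) v := fun p => by
    obtain ⟨h, -, -⟩ := hH.2 p
    exact exists_isClosest ⟨a h.2, Finset.mem_union_left _ (haF _)⟩ _
  choose v hv using hne
  refine ⟨⟨F', fun p => some (v p)⟩, ?_, ?_, ?_⟩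
  · intro p w hw
    obtain rfl : v p = w := by simpa using hw
    exact (hv p).1
  · simp [pc]
  · have h1 : ∑ w ∈ F', f w ≤ ∑ w ∈ F, f w + ∑ h ∈ properEdges H, f (R.get h.2) := by
      refine (Finset.sum_union_le_sum_add_sum _ _ hf).trans (add_le_add le_rfl ?_)
      refine (Finset.sum_biUnion_le_sum _ _ hf).trans ?_
      simp
    have h2 := hH.sum_le_split fun p : Fin Rhat.length => hκ0 (v p) (Rhat.get p)
    have h3 : ∑ b ∈ Finset.univ.filter (fun b => (coveredBy H b).card = 1),
        ∑ p ∈ coveredBy H b, κ (v p) (Rhat.get p) ≤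
        ∑ b ∈ Finset.univ.filter (fun b => (coveredBy H b).card = 1),
          ∑ p ∈ coveredBy H b, d (R.get b) (Rhat.get p) + ∑ j, κ (a j) (R.get j) := by
      have h4 : ∑ b ∈ Finset.univ.filter (fun b => (coveredBy H b).card = 1),
          κ (a b) (R.get b) ≤ ∑ j, κ (a j) (R.get j) :=
        Finset.sum_le_sum_of_subset_of_nonneg (Finset.filter_subset _ _) fun j _ _ => hκ0 _ _
      refine le_trans ?_ (add_le_add le_rfl h4)
      rw [← Finset.sum_add_distrib]
      refine Finset.sum_le_sum fun b hb => ?_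
      obtain ⟨p, hp⟩ := Finset.card_eq_one.1 (Finset.mem_filter.1 hb).2
      rw [hp, Finset.sum_singleton, Finset.sum_singleton]
      have h5 := (hv p).2 (a b) (Finset.mem_union_left _ (haF _))
      have h6 := hκ.le_add (a b) (Rhat.get p) (R.get b)
      linarith
    have h4 : ∑ h ∈ properEdges H, ∑ p ∈ h.1, κ (v p) (Rhat.get p) ≤
        ∑ h ∈ properEdges H, ∑ p ∈ h.1, κ (R.get h.2) (Rhat.get p) := by
      refine Finset.sum_le_sum fun h hh => Finset.sum_le_sum fun p _ => (hv p).2 _ ?_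
      exact Finset.mem_union_right _ (Finset.mem_biUnion.2 ⟨h, hh, by simp⟩)
    simp only [pc, Option.elim, splitCost, Finset.sum_add_distrib]
    linarith

/-! ### The learning-augmented algorithm -/

theorem exists_run_facility [Fintype V] [Nonempty V] (hf : ∀ v, 0 ≤ f v)
    (hκ : ∀ v x, 0 ≤ κ v x) {ν x₀ : ℝ} (hν : 1 ≤ ν) (R Rhat : List V)
    {PC : (Fin Rhat.length → ℝ) → PartialAssignment (Fin Rhat.length) V}
    (hPC : (pc f κ Rhat).IsApprox ν PC) :
    ∃ s, Run (alg f κ Rhat) ν x₀ PC R s :=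
  exists_run (A := alg f κ Rhat) hν hPC (S₀ := ⟨∅, fun _ => none⟩) (by simp [alg, pc])
    (by simp [alg, pc]) (fun _ => True) trivial (fun _ _ _ => trivial)
    (fun _ _ _ _ _ _ => trivial) (fun c r _ => exists_step hf c r)
    (fun _ _ _ _ h => h.cost_nonneg hf hκ) R

/-- Instance of `Run.last_le` with `O` twice the optimum. The connection cost of the bought solution
enters the phase bound, and is at most ν times the cost of the full solution. -/
theorem run_facility_cost_le [Fintype V] [Nonempty V] (hf : ∀ v, 0 ≤ f v)
    (hκ : IsConnectionCost κ d) {ν x₀ : ℝ} (hν : 1 ≤ ν) (hx : 0 < x₀) {R Rhat : List V}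
    {PC : (Fin Rhat.length → ℝ) → PartialAssignment (Fin Rhat.length) V}
    (hPC : (pc f κ Rhat).IsApprox ν PC) {s : FrameworkState (Config V)}
    (h : Run (alg f κ Rhat) ν x₀ PC R s) {k : ℕ}
    {H₁ : Finset (Finset (Fin Rhat.length) × Fin R.length)} (hH₁ : IsHyperedgeCover ⊤ H₁)
    {H₂ : Finset (Finset (Fin R.length) × Fin Rhat.length)}
    (hH₂ : IsHyperedgeCover (k : ℕ∞) H₂) :
    configCost f κ s.cfg ≤ (2 + 6 * ν) * ((3 + 4 * ν) * (opt f κ R +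
      splitCost (fun b => f (R.get b)) (fun b p => κ (R.get b) (Rhat.get p))
        (fun b p => d (R.get b) (Rhat.get p)) H₁) + 12 * (1 + Real.log k) *
      splitCost (fun b => f (Rhat.get b)) (fun b p => κ (Rhat.get b) (R.get p))
        (fun b p => d (Rhat.get b) (R.get p)) H₂) := by
  classical
  have hκ0 := hκ.cost_nonneg
  have hlog := Real.log_natCast_nonneg k
  have hcost : ∀ S, 0 ≤ (pc f κ Rhat).cost S := fun S => by
    refine add_nonneg (Finset.sum_nonneg fun v _ => hf v) (Finset.sum_nonneg fun i _ => ?_)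
    cases S.assign i with
    | none => exact le_rfl
    | some v => exact hκ0 _ _
  set L₁ := splitCost (fun b => f (R.get b)) (fun b p => κ (R.get b) (Rhat.get p))
        (fun b p => d (R.get b) (Rhat.get p)) H₁ with hL₁
  set L₂ := splitCost (fun b => f (Rhat.get b)) (fun b p => κ (Rhat.get b) (R.get p))
        (fun b p => d (Rhat.get b) (R.get p)) H₂ with hL₂
  have hL₁0 : 0 ≤ L₁ := splitCost_nonneg (fun _ => hf _) (fun _ _ => hκ0 _ _)
    (fun _ _ => hκ.nonneg _ _) H₁
  have hL₂0 : 0 ≤ L₂ := splitCost_nonneg (fun _ => hf _) (fun _ _ => hκ0 _ _)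
    (fun _ _ => hκ.nonneg _ _) H₂
  obtain ⟨F, aopt, haF, hopt⟩ := exists_opt f κ R
  have hopt0 : 0 ≤ opt f κ R := by
    rw [hopt]
    exact add_nonneg (Finset.sum_nonneg fun v _ => hf v) (Finset.sum_nonneg fun i _ => hκ0 _ _)
  obtain ⟨S, hS, hfull, hSc⟩ := exists_full_pc hf hκ R Rhat hH₁
  have hS0 := hcost S
  have h1 := h.cost_le hν (configCost f κ) (by simp [alg, configCost])
    (fun c r c' g hc => by
      simp only [alg] at hc
      cases hc with
      | stay v =>
        simp only [configCost, List.map_cons, List.sum_cons]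
        linarith
      | add w v hw =>
        simp only [configCost, List.map_cons, List.sum_cons, Finset.sum_insert hw]
        linarith)
    (fun c S => by
      have h1 := Finset.sum_union_le_sum_add_sum c.opened S.opened hf
      have h2 : 0 ≤ ∑ i, (S.assign i).elim 0 fun v => κ v (Rhat.get i) :=
        Finset.sum_nonneg fun i _ => by
          cases S.assign i with
          | none => exact le_rfl
          | some v => exact hκ0 _ _
      simp only [alg, pc, configCost]
      linarith)
    (fun _ _ _ _ h => Step.cost_nonneg hf hκ0 h)
  have h2 := h.last_le hν hx hPC hcost hS hfull (fun _ => True) (fun c => c.clients = [])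
    trivial rfl (fun _ _ _ => trivial) (fun _ _ => rfl) (fun _ _ _ _ _ _ => trivial) R.length
    (fun i => R.getD i (Classical.arbitrary V)) (O := 2 * opt f κ R)
    (Y := 2 * (ν * (pc f κ Rhat).cost S) + 6 * (1 + Real.log k) * L₂) (by positivity)
    (by positivity)
    -- The dual variable of the new client is at most the threshold of its facility in the optimal
    -- solution, hence at most the optimum; the reserve that pays for the rest is at most the cost
    -- of the phase so far.
    (fun m n c c' c'' t g₀ cs g _ hJ hp hn hs => by
      obtain ⟨hfeas, a, ha⟩ := exists_duals hf hκ0 hJ hp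
      have i1 := phase_reconnection_le hp hJ ha hp.le le_rfl
      rw [hp.last, ← hp.total] at i1
      obtain ⟨b, hb⟩ := Step.exists_isDual hf hκ0 (hp.last ▸ hfeas n hp.le le_rfl) hs
      have i2 := hb.cost_add_le
      have i3 : 0 ≤ reconnection κ c'' :=
        List.sum_nonneg (by simpa using fun y _ => toSet_nonneg hκ0 _ y)
      have i4 := hb.le_threshold (aopt ⟨n, hn⟩)
      have i5 := potential_nonneg (κ := κ) c' (aopt ⟨n, hn⟩)
      have i6 : f (aopt ⟨n, hn⟩) ≤ ∑ v ∈ F, f v :=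
        Finset.single_le_sum (fun v _ => hf v) (haF _)
      have i7 : κ (aopt ⟨n, hn⟩) (R.get ⟨n, hn⟩) ≤ ∑ i, κ (aopt i) (R.get i) :=
        Finset.single_le_sum (f := fun i => κ (aopt i) (R.get i)) (fun i _ => hκ0 _ _)
          (Finset.mem_univ _)
      have i8 : R.getD n (Classical.arbitrary V) = R.get ⟨n, hn⟩ := by simp [hn]
      rw [threshold, i8] at i4
      linarith)
    (fun m n c c' t cs g S' _ hS' hu hc _ hp hn => by
      have hassign : ∀ j, ∃ v, S'.assign j = some v := fun j => by
        have hu' : (pc f κ Rhat).unsat S' = ∅ := hu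
        have : j ∉ (pc f κ Rhat).unsat S' := by simp [hu']
        simp only [pc, Finset.mem_filter, Finset.mem_univ, true_and] at this
        exact Option.ne_none_iff_exists'.1 this
      choose v hv using hassign
      obtain ⟨-, a, ha⟩ := exists_duals hf hκ0 rfl hp
      have i1 := facility_phase_le hp rfl ha hf hκ (R := R) (Rhat := Rhat)
        (fun i => by simp) hn
        (v := v) (fun j => Finset.mem_union_right _ (hS' j (v j) (hv j))) hH₂
      have hc' : (pc f κ Rhat).cost S' ≤ ν * (pc f κ Rhat).cost S := hc
      have i2 : (pc f κ Rhat).cost S' =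
          ∑ v ∈ S'.opened, f v + ∑ j, κ (v j) (Rhat.get j) := by
        simp [pc, hv]
      have i3 := Finset.sum_nonneg fun v (_ : v ∈ S'.opened) => hf v
      linarith)
    le_rfl (fun i hi => by simp [hi])
  have h3 : (alg f κ Rhat).offline.cost S ≤ opt f κ R + L₁ := hSc
  have h4 : s.last ≤ (3 + 4 * ν) * (opt f κ R + L₁) + 12 * (1 + Real.log k) * L₂ := by
    have h5 := mul_le_mul_of_nonneg_left hSc (by linarith : 0 ≤ 4 * ν + 1)
    have h6 : (alg f κ Rhat).offline.cost S = (pc f κ Rhat).cost S := rfl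
    linarith
  have h5 := mul_le_mul_of_nonneg_left h4 (by linarith : 0 ≤ 2 + 6 * ν)
  linarith [h1.1, h1.2.2.2]

end Facility

/-! ### Reduction of soft capacities to connection costs -/

namespace Network

variable {V : Type u} (N : Network V)

theorem isConnectionCost_dist : Facility.IsConnectionCost N.dist N.dist where
  nonneg := N.dist_nonneg
  comm := N.dist_comm
  triangle := N.dist_triangle
  le _ _ := le_rfl
  le_add v x y := N.dist_triangle v y x

end Network

namespace Facility

variable {V : Type u} {f : V → ℝ} {d : V → V → ℝ} {β : V → ℕ}

theorem IsConnectionCost.capκ (h : IsConnectionCost d d) (hf : ∀ v, 0 ≤ f v) :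
    IsConnectionCost (capκ f d β) d where
  nonneg := h.nonneg
  comm := h.comm
  triangle := h.triangle
  le v x := le_add_of_nonneg_right (div_nonneg (hf v) (Nat.cast_nonneg _))
  le_add v x y := by
    have := h.le_add v x y
    simp only [Facility.capκ]
    linarith

theorem opt_nonneg {κ : V → V → ℝ} (hf : ∀ v, 0 ≤ f v) (hκ : ∀ v x, 0 ≤ κ v x) (R : List V) :
    0 ≤ opt f κ R := by
  refine Real.sInf_nonneg ?_
  rintro _ ⟨F, a, -, rfl⟩
  exact add_nonneg (Finset.sum_nonneg fun v _ => hf v) (Finset.sum_nonneg fun i _ => hκ _ _)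

/-- One facility at each used vertex costs no more than the `m v` facilities there, and neither do
the shares `f v / β v` of the at most `m v * β v` clients; hence the factor 2. -/
theorem opt_capκ_le [Fintype V] [Nonempty V] (hf : ∀ v, 0 ≤ f v) (hβ : ∀ v, 1 ≤ β v)
    (h : IsConnectionCost d d) (R : List V) :
    opt f (capκ f d β) R ≤ 2 * capOpt f d β R := by
  classical
  have key : opt f (capκ f d β) R / 2 ≤ capOpt f d β R := by
    refine le_csInf ⟨_, fun _ => R.length, fun _ => Classical.arbitrary V, fun v => ?_, rfl⟩ ?_
    · refine (Finset.card_le_univ _).trans ?_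
      rw [Fintype.card_fin]
      exact Nat.le_mul_of_pos_right _ (hβ v)
    rintro _ ⟨m, a, hm, rfl⟩
    have hβ0 : ∀ v, (0 : ℝ) < β v := fun v => by exact_mod_cast hβ v
    have h1 : opt f (capκ f d β) R ≤ ∑ v ∈ Finset.univ.filter (fun v => 1 ≤ m v), f v +
        ∑ i, capκ f d β (a i) (R.get i) := by
      refine csInf_le (opt_bddBelow hf (h.capκ hf).cost_nonneg R) ⟨_, a, fun i => ?_, rfl⟩
      simp only [Finset.mem_filter, Finset.mem_univ, true_and]
      by_contra hcon
      have hm0 : m (a i) = 0 := by omega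
      have := hm (a i)
      rw [hm0, zero_mul, Nat.le_zero, Finset.card_eq_zero, Finset.filter_eq_empty_iff] at this
      exact this (Finset.mem_univ i) rfl
    have h2 : ∑ v ∈ Finset.univ.filter (fun v => 1 ≤ m v), f v ≤ ∑ v, f v * m v := by
      refine (Finset.sum_le_sum fun v hv => ?_).trans
        (Finset.sum_le_sum_of_subset_of_nonneg (Finset.filter_subset _ _) fun v _ _ =>
          mul_nonneg (hf v) (Nat.cast_nonneg _))
      have : (1 : ℝ) ≤ m v := by exact_mod_cast (Finset.mem_filter.1 hv).2
      exact le_mul_of_one_le_right (hf v) this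
    have h3 : ∑ i, f (a i) / β (a i) ≤ ∑ v, f v * m v := by
      rw [← Finset.sum_fiberwise Finset.univ a]
      refine Finset.sum_le_sum fun v _ => ?_
      rw [Finset.sum_congr rfl (g := fun _ => f v / β v) fun i hi => by
        rw [(Finset.mem_filter.1 hi).2], Finset.sum_const, nsmul_eq_mul]
      have h4 : ((Finset.univ.filter fun i => a i = v).card : ℝ) ≤ m v * β v := by
        exact_mod_cast hm v
      calc _ ≤ (m v * β v : ℝ) * (f v / β v) :=
            mul_le_mul_of_nonneg_right h4 (div_nonneg (hf v) (hβ0 v).le)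
        _ = f v * m v := by
            have := (hβ0 v).ne'
            field_simp
    have h4 : 0 ≤ ∑ i, d (a i) (R.get i) := Finset.sum_nonneg fun i _ => h.nonneg _ _
    simp only [capκ, Finset.sum_add_distrib] at h1
    linarith
  linarith

theorem sum_load_mul_le {φ : V → ℝ} (hφ : ∀ v, 0 ≤ φ v) (s : Config V) (F : Finset V) :
    ∑ v ∈ F, (load s v : ℝ) * φ v ≤ (s.conns.map fun p => φ p.2).sum := by
  classical
  unfold load
  induction s.conns with
  | nil => simp
  | cons p l ih =>
    have h1 : ∀ v, (((p :: l).filter fun q => decide (q.2 = v)).length : ℝ) * φ v =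
        ((l.filter fun q => decide (q.2 = v)).length : ℝ) * φ v + if p.2 = v then φ v else 0 := by
      intro v
      by_cases h : p.2 = v
      · simp [h]
        ring
      · simp [h]
    have h2 : ∑ v ∈ F, (if p.2 = v then φ v else 0) ≤ φ p.2 := by
      rw [Finset.sum_ite_eq]
      split_ifs
      exacts [le_rfl, hφ _]
    simp only [List.map_cons, List.sum_cons]
    calc _ = ∑ v ∈ F, (((l.filter fun q => decide (q.2 = v)).length : ℝ) * φ v +
            if p.2 = v then φ v else 0) := Finset.sum_congr rfl fun v _ => h1 v
      _ ≤ _ := by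
          rw [Finset.sum_add_distrib]
          linarith

/-- Rounding the number of facilities up adds at most one facility, paid by the opening; the
fractional part is paid by the clients' shares. -/
theorem capConfigCost_le (hf : ∀ v, 0 ≤ f v) (s : Config V) :
    capConfigCost f d β s ≤ configCost f (capκ f d β) s := by
  have h1 := sum_load_mul_le (φ := fun v => f v / β v)
    (fun v => div_nonneg (hf v) (Nat.cast_nonneg _)) s s.opened
  have h2 : ∑ v ∈ s.opened, f v * (max 1 ⌈(load s v : ℝ) / β v⌉₊ : ℕ) ≤
      ∑ v ∈ s.opened, (f v + (load s v : ℝ) * (f v / β v)) := by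
    refine Finset.sum_le_sum fun v _ => ?_
    have h3 : (0 : ℝ) ≤ (load s v : ℝ) / β v := by positivity
    have h4 : ((max 1 ⌈(load s v : ℝ) / β v⌉₊ : ℕ) : ℝ) ≤ 1 + (load s v : ℝ) / β v := by
      rw [Nat.cast_max, Nat.cast_one]
      exact max_le (by linarith) (by linarith [(Nat.ceil_lt_add_one h3).le])
    calc _ ≤ f v * (1 + (load s v : ℝ) / β v) := mul_le_mul_of_nonneg_left h4 (hf v)
      _ = _ := by ring
  rw [Finset.sum_add_distrib] at h2
  simp only [capConfigCost, configCost, capκ, List.sum_map_add]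
  linarith

theorem splitCost_le_γ (hf : ∀ v, 0 ≤ f v) (h : IsConnectionCost d d) (R₁ R₂ : List V)
    (H : Finset (Finset (Fin R₁.length) × Fin R₂.length)) :
    splitCost (fun b => f (R₂.get b)) (fun b p => d (R₂.get b) (R₁.get p))
      (fun b p => d (R₂.get b) (R₁.get p)) H ≤
        refinedCost (fun b => f (R₂.get b)) (γ f d R₁ R₂) H := by
  have := splitCost_le_refinedCost (f := fun b => f (R₂.get b))
    (κ := fun b p => d (R₂.get b) (R₁.get p)) (d := fun b p => d (R₂.get b) (R₁.get p))
    (γ := γ f d R₁ R₂) le_rfl (fun _ _ => h.nonneg _ _)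
    (fun A b => add_nonneg (hf _) (Finset.sum_nonneg fun _ _ => h.nonneg _ _))
    (fun A b _ => le_rfl) (fun A b _ => (one_mul _).ge) H
  linarith

/-- For a nonempty hyperedge, the first facility and the sum of the shares are each at most the cost
of the rounded-up number of facilities. -/
theorem splitCost_le_capγ (hf : ∀ v, 0 ≤ f v) (hβ : ∀ v, 1 ≤ β v) (h : IsConnectionCost d d)
    (R₁ R₂ : List V) (H : Finset (Finset (Fin R₁.length) × Fin R₂.length)) :
    splitCost (fun b => f (R₂.get b)) (fun b p => capκ f d β (R₂.get b) (R₁.get p))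
      (fun b p => d (R₂.get b) (R₁.get p)) H ≤
        2 * refinedCost (fun b => f (R₂.get b)) (capγ f d β R₁ R₂) H := by
  have hd : ∀ (A : Finset (Fin R₁.length)) (b : Fin R₂.length),
      0 ≤ ∑ p ∈ A, d (R₂.get b) (R₁.get p) :=
    fun A b => Finset.sum_nonneg fun _ _ => h.nonneg _ _
  have hopen : ∀ (A : Finset (Fin R₁.length)) (b : Fin R₂.length), A.Nonempty →
      f (R₂.get b) ≤ f (R₂.get b) * (⌈(A.card : ℝ) / β (R₂.get b)⌉₊ : ℕ) := by
    intro A b hA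
    refine le_mul_of_one_le_right (hf _) ?_
    have h1 : (0 : ℝ) < A.card := by exact_mod_cast hA.card_pos
    have h2 : (0 : ℝ) < β (R₂.get b) := by exact_mod_cast hβ _
    exact_mod_cast Nat.ceil_pos.2 (div_pos h1 h2)
  refine splitCost_le_refinedCost one_le_two (fun _ _ => h.nonneg _ _)
    (fun A b => add_nonneg (mul_nonneg (hf _) (Nat.cast_nonneg _)) (hd A b))
    (fun A b hA => add_le_add (hopen A b hA) le_rfl) (fun A b hA => ?_) H
  have h1 := hopen A b hA
  have h2 := hd A b
  have h3 : f (R₂.get b) * ((A.card : ℝ) / β (R₂.get b)) ≤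
      f (R₂.get b) * (⌈(A.card : ℝ) / β (R₂.get b)⌉₊ : ℕ) :=
    mul_le_mul_of_nonneg_left (Nat.le_ceil _) (hf _)
  have h4 : (A.card : ℝ) * (f (R₂.get b) / β (R₂.get b)) =
      f (R₂.get b) * ((A.card : ℝ) / β (R₂.get b)) := by ring
  simp only [capκ, Finset.sum_add_distrib, Finset.sum_const, nsmul_eq_mul]
  linarith

end Facility

/-! ### A common constant for the three problems -/

/-- The factors 2 in the hypotheses are the loss in the reduction of soft capacities; the other two
problems satisfy them with room to spare. -/
theorem combine_le_of_le_two_mul {ν O O' X Y X' Y' L : ℝ} (hν : 1 ≤ ν) (hL : 0 ≤ L)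
    (hX0 : 0 ≤ X) (hY0 : 0 ≤ Y) (hO0 : 0 ≤ O) (hO : O ≤ 2 * O') (hX : X ≤ 2 * X')
    (hY : Y ≤ 2 * Y') :
    (2 + 6 * ν) * ((3 + 4 * ν) * (O + X) + 12 * (1 + L) * Y) ≤
      2 * (2 + 6 * ν) * (12 + 4 * ν) * O' +
        2 * (2 + 6 * ν) * (12 + 4 * ν) * (1 + L) * (X' + Y') := by
  have h1 : (3 + 4 * ν) * (O + X) + 12 * (1 + L) * Y ≤
      (12 + 4 * ν) * (O + (1 + L) * (X + Y)) := by
    have e1 := mul_nonneg hL hX0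
    have e2 := mul_nonneg hL hY0
    have hν0 : 0 ≤ ν := by linarith
    have e3 := mul_nonneg hν0 (add_nonneg e1 e2)
    have e4 := mul_nonneg hν0 hY0
    linarith
  have h2 : O + (1 + L) * (X + Y) ≤ 2 * O' + (1 + L) * (2 * X' + 2 * Y') :=
    add_le_add hO (mul_le_mul_of_nonneg_left (add_le_add hX hY) (by linarith))
  calc _ ≤ (2 + 6 * ν) * ((12 + 4 * ν) * (2 * O' + (1 + L) * (2 * X' + 2 * Y'))) :=
        mul_le_mul_of_nonneg_left
          (h1.trans (mul_le_mul_of_nonneg_left h2 (by linarith))) (by linarith)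
    _ = _ := by ring

theorem theorem3 (ν : ℝ) (hν : 1 ≤ ν) :
    ∃ C : ℝ, 0 < C ∧
      -- Steiner tree
      (∀ (V : Type u) [Fintype V] [DecidableEq V] (N : Network V) (ρ : V) (R Rhat : List V)
        (x₀ : ℝ) (PC : (Fin Rhat.length → ℝ) → Finset (Sym2 V)),
        0 < x₀ → (N.steinerPC ρ Rhat).IsApprox ν PC →
        (∃ s, Run (N.steinerAlg ρ Rhat) ν x₀ PC R s) ∧
        ∀ s, Run (N.steinerAlg ρ Rhat) ν x₀ PC R s → ∀ k : ℕ, 1 ≤ k →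
          ENNReal.ofReal (∑ e ∈ s.cfg, N.cost e) ≤
            errorBound C k (N.steinerOpt ρ R.toFinset) (N.steinerError k R Rhat)) ∧
      -- facility location
      (∀ (V : Type u) [Fintype V] (N : Network V) (f : V → ℝ) (R Rhat : List V)
        (x₀ : ℝ)
        (PC : (Fin Rhat.length → ℝ) → Facility.PartialAssignment (Fin Rhat.length) V),
        (∀ v, 0 ≤ f v) → 0 < x₀ → (Facility.pc f N.dist Rhat).IsApprox ν PC →
        (∃ s, Run (Facility.alg f N.dist Rhat) ν x₀ PC R s) ∧
        ∀ s, Run (Facility.alg f N.dist Rhat) ν x₀ PC R s → ∀ k : ℕ, 1 ≤ k →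
          ENNReal.ofReal (Facility.configCost f N.dist s.cfg) ≤
            errorBound C k (Facility.opt f N.dist R)
              (Facility.coverError f N.dist k R Rhat)) ∧
      -- soft-capacitated facility location
      (∀ (V : Type u) [Fintype V] (N : Network V) (f : V → ℝ) (β : V → ℕ) (R Rhat : List V)
        (x₀ : ℝ)
        (PC : (Fin Rhat.length → ℝ) → Facility.PartialAssignment (Fin Rhat.length) V),
        (∀ v, 0 ≤ f v) → (∀ v, 1 ≤ β v) → 0 < x₀ →
        (Facility.pc f (Facility.capκ f N.dist β) Rhat).IsApprox ν PC →
        (∃ s, Run (Facility.alg f (Facility.capκ f N.dist β) Rhat) ν x₀ PC R s) ∧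
        ∀ s, Run (Facility.alg f (Facility.capκ f N.dist β) Rhat) ν x₀ PC R s →
          ∀ k : ℕ, 1 ≤ k →
          ENNReal.ofReal (Facility.capConfigCost f N.dist β s.cfg) ≤
            errorBound C k (Facility.capOpt f N.dist β R)
              (Facility.capCoverError f N.dist β k R Rhat)) := by
  have hC : 0 < 2 * (2 + 6 * ν) * (12 + 4 * ν) := by
    have : 0 < ν := by linarith
    positivity
  refine ⟨2 * (2 + 6 * ν) * (12 + 4 * ν), hC, ?_, ?_, ?_⟩
  · intro V _ _ N ρ R Rhat x₀ PC hx hPC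
    refine ⟨Network.exists_run_steiner hν ρ R Rhat hPC, fun s hs k _ => ?_⟩
    refine ofReal_le_errorBound hC fun H₁ H₂ hH₁ hH₂ => ?_
    refine (Network.run_steiner_cost_le hν hx (X := R.toFinset) (by simp) hPC hs hH₁
      hH₂).trans ?_
    have h0 := N.steinerOpt_nonneg ρ R.toFinset
    have h1 : 0 ≤ sumCost (N.steinerγ Rhat R) H₁ :=
      Finset.sum_nonneg fun e _ => N.steinerOpt_nonneg _ _
    have h2 : 0 ≤ sumCost (N.steinerγ R Rhat) H₂ :=
      Finset.sum_nonneg fun e _ => N.steinerOpt_nonneg _ _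
    have hL := Real.log_natCast_nonneg k
    refine le_trans ?_ (combine_le_of_le_two_mul hν hL h1 h2 h0 (by linarith)
      (by linarith) (by linarith))
    refine mul_le_mul_of_nonneg_left ?_ (by linarith)
    have h3 := mul_nonneg hL h2
    have h4 := mul_le_mul_of_nonneg_right hν h0
    have h5 := mul_le_mul_of_nonneg_right hν h1
    linarith
  · intro V _ N f R Rhat x₀ PC hf hx hPC
    have : Nonempty V := N.connected.nonempty
    have hd := N.isConnectionCost_dist
    refine ⟨Facility.exists_run_facility hf hd.cost_nonneg hν R Rhat hPC, fun s hs k _ => ?_⟩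
    refine ofReal_le_errorBound hC fun H₁ H₂ hH₁ hH₂ => ?_
    refine (Facility.run_facility_cost_le hf hd hν hx hPC hs hH₁ hH₂).trans ?_
    have h0 := Facility.opt_nonneg hf hd.cost_nonneg R
    have h1 := Facility.splitCost_le_γ hf hd Rhat R H₁
    have h2 := Facility.splitCost_le_γ hf hd R Rhat H₂
    have h3 := splitCost_nonneg (fun b => hf (R.get b))
      (fun b p => hd.nonneg (R.get b) (Rhat.get p))
      (fun b p => hd.nonneg (R.get b) (Rhat.get p)) H₁
    have h4 := splitCost_nonneg (fun b => hf (Rhat.get b))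
      (fun b p => hd.nonneg (Rhat.get b) (R.get p))
      (fun b p => hd.nonneg (Rhat.get b) (R.get p)) H₂
    exact combine_le_of_le_two_mul hν (Real.log_natCast_nonneg k) h3 h4 h0 (by linarith)
      (by linarith) (by linarith)
  · intro V _ N f β R Rhat x₀ PC hf hβ hx hPC
    have : Nonempty V := N.connected.nonempty
    have hd := N.isConnectionCost_dist
    have hκ := hd.capκ (f := f) (β := β) hf
    refine ⟨Facility.exists_run_facility hf hκ.cost_nonneg hν R Rhat hPC, fun s hs k _ => ?_⟩
    refine ofReal_le_errorBound hC fun H₁ H₂ hH₁ hH₂ => ?_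
    refine (Facility.capConfigCost_le hf s.cfg).trans
      ((Facility.run_facility_cost_le hf hκ hν hx hPC hs hH₁ hH₂).trans ?_)
    exact combine_le_of_le_two_mul hν (Real.log_natCast_nonneg k)
      (splitCost_nonneg (fun _ => hf _) (fun _ _ => hκ.cost_nonneg _ _)
        (fun _ _ => hκ.nonneg _ _) H₁)
      (splitCost_nonneg (fun _ => hf _) (fun _ _ => hκ.cost_nonneg _ _)
        (fun _ _ => hκ.nonneg _ _) H₂)
      (Facility.opt_nonneg hf hκ.cost_nonneg R) (Facility.opt_capκ_le hf hβ hd R)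
      (Facility.splitCost_le_capγ hf hβ hd Rhat R H₁)
      (Facility.splitCost_le_capγ hf hβ hd R Rhat H₂)
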